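/- Let $\alpha\in\mathbb C$ and $a>1$ satisfy $0<|\alpha|<1$ and $|\alpha|^2+a^{-2}=1$. On $\ell^2(\mathbb Z)$ with canonical basis $(e_k)_{k\in\mathbb Z}$ let $Te_k=e_{k+1}$ and $Ae_k=ke_k$, and let $$H_a=\frac1a\,T^*-|\alpha|^2\sum_{j\ge 0}\Big(\frac Ta\Big)^j=F_a(T),\qquad F_a(z)=\frac{1-az}{z(a-z)},$$ be the GGT matrix with constant Verblunsky coefficients $\alpha_k=\alpha$, that is $H_ae_k=\frac1a e_{k-1}-\bar\alpha\sum_{i\ge k}\alpha\, a^{-(i-k)}e_i$. Let $B_a$ be the closure of the symmetric operator $(aT+aT^*-2)A+A(aT+aT^*-2)$ defined on the linear span of the $e_k$ (this closure is self-adjoint). Let $f_a(\theta)=F_a(e^{i\theta})$, $\theta_a=\arccos(a^{-1})$, and let $\Theta_a=\{e^{i\theta}:\arg f_a(-\theta_a)\le\theta\le\arg f_a(\theta_a)\}$, with $\arg$ taking values in $[0,2\pi)$. For a self-adjoint operator $B$ and a unitary operator $U$ of class $C^1(B)$ (i.e. the form $\langle B\varphi,U\psi\rangle-\langle\varphi,UB\psi\rangle$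 on $\mathcal D(B)\times\mathcal D(B)$ is the form of a bounded operator $\mathrm{ad}_BU$), write $U^*BU-B$ for the bounded operator $U^*(\mathrm{ad}_BU)$. Let $E_\Theta$ denote the spectral projections of $U$. One says that $U$ is weakly propagating with respect to $B$ if $U^*BU-B$ is non-negative and injective, and strictly propagating with respect to $B$ on a Borel set $\Theta$ of the circle if there is $c>0$ with $E_\Theta(U^*BU-B)E_\Theta\ge cE_\Theta$. Then $H_a$ is unitary and of class $C^1(B_a)$, and: 1. $H_a$ is weakly propagating with respect to $B_a$; 2. $H_a$ is strictly propagating with respect to $B_a$ on every subarc $\Theta$ of $\Theta_a$ whose closure contains neither endpoint of $\Theta_a$. Consequently, $H_a$ has purely absolutely continuous spectrum. -/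

import Mathlib

open MeasureTheory
open scoped InnerProductSpace ComplexConjugate

noncomputable section

namespace GGT

/-! ### The torus and spectral families of unitary operators -/

/-- The one-dimensional torus `ℝ / 2πℤ`. -/
abbrev Torus : Type := AddCircle (2 * Real.pi)

instance factTwoPiPos : Fact (0 < 2 * Real.pi) := ⟨Real.two_pi_pos⟩

section Abstract

variable {E : Type*} [NormedAddCommGroup E] [InnerProductSpace ℂ E] [CompleteSpace E]

/-- The spectral family of `U`: a projection-valued Borel measure `Δ ↦ E_Δ` on the torus with
`U = ∫ e^{iθ} dE(θ)`. The scalar measures `⟨φ, E_Δ φ⟩ = ‖E_Δ φ‖²` are carried as `measure φ`;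
only the values of `proj` on Borel sets are meaningful. -/
structure SpectralFamily (U : E →L[ℂ] E) where
  proj : Set Torus → E →L[ℂ] E
  isStarProjection_proj : ∀ Δ, MeasurableSet Δ → IsStarProjection (proj Δ)
  proj_univ : proj Set.univ = 1
  measure : E → Measure Torus
  measure_apply : ∀ φ Δ, MeasurableSet Δ → measure φ Δ = ENNReal.ofReal (‖proj Δ φ‖ ^ 2)
  inner_eq_integral : ∀ φ, ⟪φ, U φ⟫_ℂ = ∫ θ, (AddCircle.toCircle θ : ℂ) ∂(measure φ)

/-- `U` has purely absolutely continuous spectrum: every spectral measure of `U` is absolutely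
continuous with respect to Lebesgue measure on the torus. -/
def HasPurelyACSpectrum (U : E →L[ℂ] E) : Prop :=
  ∃ P : SpectralFamily U, ∀ φ, P.measure φ ≪ (volume : Measure Torus)

/-! ### Commutators and propagation -/

/-- The bounded operator `C` is `ad_A B = [A, B]`: on the domain of `A` the sesquilinear form
`⟨A φ, B ψ⟩ - ⟨φ, B A ψ⟩` is that of `C`. A bounded `B` is of class `C¹(A)` if such a `C` exists;
for densely defined `A` it is then unique. -/
def IsCommutator (A : E →ₗ.[ℂ] E) (B C : E →L[ℂ] E) : Prop :=
  ∀ φ ψ : A.domain, ⟪A φ, B ψ⟫_ℂ - ⟪(φ : E), B (A ψ)⟫_ℂ = ⟪(φ : E), C ψ⟫_ℂ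

/-- The bounded operator `D` is `U* A U - A`, that is `U* (ad_A U)`, where `A` is self-adjoint and
`U` is a unitary operator of class `C¹(A)`. -/
def IsConjugationDefect (A : E →ₗ.[ℂ] E) (U D : E →L[ℂ] E) : Prop :=
  IsSelfAdjoint A ∧ U ∈ unitary (E →L[ℂ] E) ∧
    ∃ C : E →L[ℂ] E, IsCommutator A U C ∧ D = ContinuousLinearMap.adjoint U ∘L C

/-- `U` is weakly propagating with respect to `A`: `U* A U - A` is non-negative and injective. -/
def IsWeaklyPropagating (U : E →L[ℂ] E) (A : E →ₗ.[ℂ] E) : Prop :=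
  ∃ D : E →L[ℂ] E, IsConjugationDefect A U D ∧ D.IsPositive ∧ Function.Injective D

/-- `U` is strictly propagating with respect to `A` on the Borel set `Θ`:
`E_Θ (U* A U - A) E_Θ ≥ c E_Θ` for some `c > 0`. -/
def IsStrictlyPropagatingOn (U : E →L[ℂ] E) (A : E →ₗ.[ℂ] E) (Θ : Set Torus) : Prop :=
  MeasurableSet Θ ∧ ∃ D : E →L[ℂ] E, IsConjugationDefect A U D ∧
    ∃ P : SpectralFamily U, ∃ c : ℝ, 0 < c ∧
      (P.proj Θ ∘L D ∘L P.proj Θ - (c : ℂ) • P.proj Θ).IsPositive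

/-- Precomposition of an unbounded operator with a bounded one, on its natural domain
`{u | G u ∈ D(A)}`. -/
def precomp (A : E →ₗ.[ℂ] E) (G : E →L[ℂ] E) : E →ₗ.[ℂ] E where
  domain := A.domain.comap (G : E →ₗ[ℂ] E)
  toFun := A.toFun ∘ₗ (G : E →ₗ[ℂ] E).restrict (fun _ hx => hx)

end Abstract

/-! ### Operators on `ℓ²(ℤ)` -/

/-- The Hilbert space `ℓ²(ℤ)`. -/
abbrev EllTwo : Type := lp (fun _ : ℤ => ℂ) 2

/-- The canonical orthonormal basis. -/
def e (k : ℤ) : EllTwo := lp.single 2 k 1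

theorem memℓp_shift (n : ℤ) (u : EllTwo) : Memℓp (fun k : ℤ => u (k + n)) 2 := by
  have h := (memℓp_gen_iff (p := 2) (by norm_num)).1 (lp.memℓp u)
  exact (memℓp_gen_iff (p := 2) (by norm_num)).2 ((Equiv.addRight n).summable_iff.2 h)

/-- `u ↦ (u (k + n))_k`, as a linear isometry. -/
def shiftIsometry (n : ℤ) : EllTwo →ₗᵢ[ℂ] EllTwo where
  toFun u := ⟨fun k => u (k + n), memℓp_shift n u⟩
  map_add' _ _ := rfl
  map_smul' _ _ := rfl
  norm_map' u := by
    have h : (0 : ℝ) < (2 : ENNReal).toReal := by norm_num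
    refine (Real.rpow_left_inj (norm_nonneg _) (norm_nonneg _) h.ne').1 ?_
    rw [lp.norm_rpow_eq_tsum h, lp.norm_rpow_eq_tsum h]
    exact (Equiv.addRight n).tsum_eq (fun k => ‖u k‖ ^ (2 : ENNReal).toReal)

/-- The shift `T`, with `T e_k = e_{k+1}`. -/
def T : EllTwo →L[ℂ] EllTwo := (shiftIsometry (-1)).toContinuousLinearMap

/-- The position operator `A`, with `A e_k = k e_k`, on its maximal domain. -/
def position : EllTwo →ₗ.[ℂ] EllTwo where
  domain :=
    { carrier := {u | Memℓp (fun k : ℤ => (k : ℂ) * u k) 2}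
      add_mem' := fun {u v} hu hv => by
        have h : (fun k : ℤ => (k : ℂ) * (u + v) k) =
            (fun k : ℤ => (k : ℂ) * u k) + fun k : ℤ => (k : ℂ) * v k := by
          funext k; simp [mul_add]
        simpa only [Set.mem_ofPred_eq, h] using hu.add hv
      zero_mem' := by
        have h : (fun k : ℤ => (k : ℂ) * (0 : EllTwo) k) = 0 := by
          funext k; simp
        simpa only [Set.mem_ofPred_eq, h] using zero_memℓp
      smul_mem' := fun c u hu => by
        have h : (fun k : ℤ => (k : ℂ) * (c • u) k) = c • fun k : ℤ => (k : ℂ) * u k := by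
          funext k; simp [mul_left_comm]
        simpa only [Set.mem_ofPred_eq, h] using hu.const_smul c }
  toFun :=
    { toFun := fun u => ⟨fun k => (k : ℂ) * (u : EllTwo) k, u.2⟩
      map_add' := fun u v => by ext k; exact mul_add _ _ _
      map_smul' := fun c u => by ext k; simp [mul_left_comm] }

/-- `H` is the GGT representation with Verblunsky coefficients `α`, where `|α_k|² + a_k⁻² = 1`:
`H e_k = a_k⁻¹ e_{k-1} - conj α_k ∑_{i ≥ k} α_{i+1} (∏_{k < j ≤ i} a_j⁻¹) e_i`. -/
def IsGGTRepresentation (α : ℤ → ℂ) (a : ℤ → ℝ) (H : EllTwo →L[ℂ] EllTwo) : Prop :=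
  (∀ k, ‖α k‖ ^ 2 + ((a k) ^ 2)⁻¹ = 1) ∧ ∀ k : ℤ, ∃ S : EllTwo,
    HasSum (fun n : ℕ =>
      (α (k + n + 1) * ∏ j ∈ Finset.Ioc k (k + n), ((a j : ℂ))⁻¹) • e (k + n)) S ∧
    H (e k) = ((a k : ℂ))⁻¹ • e (k - 1) - conj (α k) • S

/-- The GGT matrix with constant coefficients,
`H_a = a⁻¹ T* - |α|² ∑_{j ≥ 0} (T / a)^j`, where `|α|² + a⁻² = 1`. -/
def constGGT (α : ℂ) (a : ℝ) : EllTwo →L[ℂ] EllTwo :=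
  (a : ℂ)⁻¹ • ContinuousLinearMap.adjoint T
    - ((‖α‖ ^ 2 : ℝ) : ℂ) • ∑' j : ℕ, ((a : ℂ)⁻¹ • T) ^ j

/-- `F_a(z) = (1 - a z) / (z (a - z))`. -/
def symbol (a : ℝ) (z : ℂ) : ℂ := (1 - a * z) / (z * (a - z))

/-- `G_a(T) = a T + a T* - 2`. -/
def G (a : ℝ) : EllTwo →L[ℂ] EllTwo :=
  (a : ℂ) • T + (a : ℂ) • ContinuousLinearMap.adjoint T
    - (2 : ℂ) • ContinuousLinearMap.id ℂ EllTwo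

/-- The symmetric operator `G_a(T) A + A G_a(T)` on the linear span of the `e_k`. -/
def conjugateOpCore (a : ℝ) : EllTwo →ₗ.[ℂ] EllTwo :=
  ((G a : EllTwo →ₗ[ℂ] EllTwo).compPMap position + precomp position (G a)).domRestrict
    (Submodule.span ℂ (Set.range e))

/-- The conjugate operator `B_a`: the closure of `G_a(T) A + A G_a(T)`. -/
def conjugateOp (a : ℝ) : EllTwo →ₗ.[ℂ] EllTwo := (conjugateOpCore a).closure

/-! ### The arc `Θ_a` -/

/-- The argument of a complex number in `[0, 2π)`. -/
def argPos (z : ℂ) : ℝ := toIcoMod Real.two_pi_pos 0 z.arg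

/-- `f_a(θ) = F_a(e^{iθ})`. -/
def circleSymbol (a θ : ℝ) : ℂ := symbol a (Circle.exp θ)

/-- The lower endpoint `arg f_a(-θ_a)` of `Θ_a`, where `θ_a = arccos a⁻¹`. -/
def arcLower (a : ℝ) : ℝ := argPos (circleSymbol a (-Real.arccos a⁻¹))

/-- The upper endpoint `arg f_a(θ_a)` of `Θ_a`. -/
def arcUpper (a : ℝ) : ℝ := argPos (circleSymbol a (Real.arccos a⁻¹))

/-- The arc `Θ_a`, as a subset of the torus. -/
def arc (a : ℝ) : Set Torus := (fun θ : ℝ => (θ : Torus)) '' Set.Icc (arcLower a) (arcUpper a)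

/-- A (possibly open, closed, half-open or degenerate) arc of the torus. -/
def IsArc (Θ : Set Torus) : Prop :=
  ∃ I : Set ℝ, I.OrdConnected ∧ Θ = (fun θ : ℝ => (θ : Torus)) '' I

end GGT

end

noncomputable section

namespace GGT

/-! ### Multiplication operators in the Fourier picture -/

/-! Under Fourier series `T` becomes multiplication by `z = e^{iθ}`, and `H_a` becomes
multiplication by `F_a(z)`, which has modulus one on the circle. Write `F_a(e^{iθ}) = e^{iφ(θ)}`
with `φ'(θ) = 2 (a cos θ - 1) / |a - z|²`. The position operator acts as `-i d/dθ`, so `W = [A,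
H_a]` is multiplication by `φ' F_a`. Since `G_a(T)` has symbol `2 (a cos θ - 1)` and commutes with
functions of `T`, `[B_a, H_a] = 2 G_a W`, and `H_a* B_a H_a - B_a` is multiplication by `2 (2 (a cos
θ - 1))² / |a - z|²`. The factor `G_a` is there to correct the sign of `φ'`.

This symbol is nonnegative and vanishes only at `±θ_a`, which gives weak propagation. The phase
sends these two points to the endpoints of `Θ_a`; away from the endpoints, compactness bounds the
symbol below, which gives strict propagation. The spectral projections of `H_a` are multiplications
by indicators of phase preimages, so each spectral measure is the image under the phase of an
absolutely continuous measure. As `φ'` has only two zeros, this image is again absolutely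
continuous.

The unbounded operator needs separate care (`conjugateOp_isSelfAdjoint`): its matrix is Jacobi with
linearly growing entries, and truncation by slowly varying tents shows that the adjoint lies in the
closure. The commutator is computed on basis vectors and extended to the closure
(`isConjugationDefect_defect`). -/

open AddCircle in
/-- The Fourier series isometry `ℓ²(ℤ) ≃ L²(𝕋)`. -/
def fourierEquiv : EllTwo ≃ₗᵢ[ℂ] Lp ℂ 2 (haarAddCircle (T := 2 * Real.pi)) :=
  fourierBasis.repr.symm

/-- The normalised Haar measure of the torus. -/
abbrev haarTorus : Measure Torus := AddCircle.haarAddCircle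

open scoped Classical in
/-- The operator on `ℓ²(ℤ)` which is multiplication by the bounded function `g` on the Fourier
side (and `0` if `g` is not essentially bounded). -/
def multiplier (g : Torus → ℂ) : EllTwo →L[ℂ] EllTwo :=
  if h : MemLp g ⊤ haarTorus then
    (fourierEquiv.symm.toContinuousLinearEquiv : _ →L[ℂ] _) ∘L
      (ContinuousLinearMap.mul ℂ ℂ).holderL haarTorus ⊤ 2 2 h.toLp ∘L
      (fourierEquiv.toContinuousLinearEquiv : _ →L[ℂ] _)
  else 0

theorem fourierEquiv_multiplier {g : Torus → ℂ} (hg : MemLp g ⊤ haarTorus) (u : EllTwo) :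
    fourierEquiv (multiplier g u) =ᵐ[haarTorus] fun θ => g θ * fourierEquiv u θ := by
  have h1 : fourierEquiv (multiplier g u) =
      (ContinuousLinearMap.mul ℂ ℂ).holder 2 hg.toLp (fourierEquiv u) := by
    simp [multiplier, hg, ContinuousLinearMap.holderL, ContinuousLinearMap.holderₗ]
  rw [h1]
  filter_upwards [(ContinuousLinearMap.mul ℂ ℂ).coeFn_holder (r := 2) hg.toLp (fourierEquiv u),
    hg.coeFn_toLp] with θ h2 h3
  rw [h2, h3]
  rfl

theorem multiplier_ext {g : Torus → ℂ} (hg : MemLp g ⊤ haarTorus) (X : EllTwo →L[ℂ] EllTwo)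
    (h : ∀ u, fourierEquiv (X u) =ᵐ[haarTorus] fun θ => g θ * fourierEquiv u θ) :
    multiplier g = X := by
  ext1 u
  apply fourierEquiv.injective
  apply Lp.ext
  exact (fourierEquiv_multiplier hg u).trans (h u).symm

theorem multiplier_mul {g h : Torus → ℂ} (hg : MemLp g ⊤ haarTorus) (hh : MemLp h ⊤ haarTorus) :
    multiplier (g * h) = multiplier g ∘L multiplier h := by
  refine multiplier_ext (hh.mul hg) _ fun u => ?_
  filter_upwards [fourierEquiv_multiplier hg (multiplier h u), fourierEquiv_multiplier hh u]
    with θ h1 h2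
  simp only [ContinuousLinearMap.comp_apply, h1, h2, Pi.mul_apply, mul_assoc]

theorem multiplier_add {g h : Torus → ℂ} (hg : MemLp g ⊤ haarTorus) (hh : MemLp h ⊤ haarTorus) :
    multiplier (g + h) = multiplier g + multiplier h := by
  refine multiplier_ext (hg.add hh) _ fun u => ?_
  rw [add_apply, map_add]
  filter_upwards [fourierEquiv_multiplier hg u, fourierEquiv_multiplier hh u,
    Lp.coeFn_add (fourierEquiv (multiplier g u)) (fourierEquiv (multiplier h u))] with θ h1 h2 h3
  simp only [h1, h2, h3, Pi.add_apply, add_mul]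

theorem multiplier_smul {g : Torus → ℂ} (hg : MemLp g ⊤ haarTorus) (c : ℂ) :
    multiplier (c • g) = c • multiplier g := by
  refine multiplier_ext (hg.const_smul c) _ fun u => ?_
  rw [smul_apply, map_smul]
  filter_upwards [fourierEquiv_multiplier hg u,
    Lp.coeFn_smul c (fourierEquiv (multiplier g u))] with θ h1 h2
  simp only [h1, h2, Pi.smul_apply, smul_eq_mul, mul_assoc]

theorem multiplier_sub {g h : Torus → ℂ} (hg : MemLp g ⊤ haarTorus) (hh : MemLp h ⊤ haarTorus) :
    multiplier (g - h) = multiplier g - multiplier h := by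
  have h1 : g - h = g + (-1 : ℂ) • h := by simp [sub_eq_add_neg]
  rw [h1, multiplier_add hg (hh.const_smul _), multiplier_smul hh]
  simp [sub_eq_add_neg]

theorem multiplier_one : multiplier 1 = 1 := by
  refine multiplier_ext (memLp_const 1) _ fun u => ?_
  simp

theorem multiplier_conj {g : Torus → ℂ} (hg : MemLp g ⊤ haarTorus) :
    multiplier (star g) = ContinuousLinearMap.adjoint (multiplier g) := by
  rw [ContinuousLinearMap.eq_adjoint_iff]
  intro u v
  rw [← fourierEquiv.inner_map_map, ← fourierEquiv.inner_map_map u, L2.inner_def, L2.inner_def]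
  refine integral_congr_ae ?_
  filter_upwards [fourierEquiv_multiplier hg v, fourierEquiv_multiplier hg.star u] with θ h1 h2
  rw [h1, h2]
  simp only [RCLike.inner_apply, map_mul, Pi.star_apply, RCLike.star_def, RCLike.conj_conj]
  ring

theorem multiplier_isPositive {d : Torus → ℝ} (hd : MemLp (fun θ => (d θ : ℂ)) ⊤ haarTorus)
    (h0 : ∀ θ, 0 ≤ d θ) : (multiplier fun θ => (d θ : ℂ)).IsPositive := by
  rw [ContinuousLinearMap.isPositive_iff_complex]
  intro u
  have key : ⟪multiplier (fun θ => (d θ : ℂ)) u, u⟫_ℂ =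
      ((∫ θ, d θ * ‖fourierEquiv u θ‖ ^ 2 ∂haarTorus : ℝ) : ℂ) := by
    rw [← fourierEquiv.inner_map_map, L2.inner_def, ← integral_complex_ofReal]
    refine integral_congr_ae ?_
    filter_upwards [fourierEquiv_multiplier hd u] with θ h1
    rw [h1]
    simp only [RCLike.inner_apply, map_mul, Complex.conj_ofReal, Complex.ofReal_mul,
      Complex.ofReal_pow]
    rw [← Complex.mul_conj']
    ring
  rw [key]
  refine ⟨by simp, ?_⟩
  rw [RCLike.re_to_complex, Complex.ofReal_re]
  exact integral_nonneg fun θ => mul_nonneg (h0 θ) (by positivity)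

theorem multiplier_injective {g : Torus → ℂ} (hg : MemLp g ⊤ haarTorus)
    (h0 : ∀ᵐ θ ∂haarTorus, g θ ≠ 0) : Function.Injective (multiplier g) := by
  intro u v huv
  apply fourierEquiv.injective
  apply Lp.ext
  have h2 := fourierEquiv_multiplier hg u
  rw [huv] at h2
  filter_upwards [h0, fourierEquiv_multiplier hg v, h2] with θ h3 h4 h5
  rw [h4] at h5
  exact (mul_left_cancel₀ h3 h5).symm

theorem memLp_top_of_continuous {g : Torus → ℂ} (hg : Continuous g) : MemLp g ⊤ haarTorus := by
  obtain ⟨C, hC⟩ := isCompact_univ.exists_bound_of_continuousOn hg.continuousOn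
  exact memLp_top_of_bound hg.aestronglyMeasurable C (ae_of_all _ fun θ => hC θ trivial)

/-! ### Coordinates on `ℓ²(ℤ)` -/

theorem inner_e_left (k : ℤ) (u : EllTwo) : ⟪e k, u⟫_ℂ = u k := by
  simp [e, lp.inner_single_left]

theorem e_apply (j k : ℤ) : e k j = if j = k then 1 else 0 := by
  simp [e, lp.single_apply, Pi.single_apply]

theorem clm_ext_e {X Y : EllTwo →L[ℂ] EllTwo} (h : ∀ k, X (e k) = Y (e k)) : X = Y := by
  ext1 u
  have h1 := lp.hasSum_single (E := fun _ : ℤ => ℂ) (p := 2) (by simp) u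
  have h2 : ∀ k, lp.single (E := fun _ : ℤ => ℂ) 2 k (u k) = u k • e k := fun k => by
    rw [e, ← lp.single_smul, smul_eq_mul, mul_one]
  simp only [h2] at h1
  have h3 := h1.mapL X
  have h4 := h1.mapL Y
  simp only [map_smul, h] at h3 h4
  exact h3.unique h4

theorem dense_span_e : Dense (Submodule.span ℂ (Set.range e) : Set EllTwo) := by
  intro u
  have h1 := lp.hasSum_single (E := fun _ : ℤ => ℂ) (p := 2) (by simp) u
  have h2 : ∀ k, lp.single (E := fun _ : ℤ => ℂ) 2 k (u k) = u k • e k := fun k => by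
    rw [e, ← lp.single_smul, smul_eq_mul, mul_one]
  simp only [h2] at h1
  exact mem_closure_of_tendsto h1 (Filter.Eventually.of_forall fun s =>
    Submodule.sum_mem _ fun k _ => Submodule.smul_mem _ _ (Submodule.subset_span ⟨k, rfl⟩))

theorem T_apply (u : EllTwo) (k : ℤ) : T u k = u (k - 1) := rfl

theorem T_e (k : ℤ) : T (e k) = e (k + 1) := by
  ext j
  simp only [T_apply, e_apply, sub_eq_iff_eq_add]

theorem adjoint_T : ContinuousLinearMap.adjoint T =
    (shiftIsometry 1).toContinuousLinearMap := by
  symm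
  rw [ContinuousLinearMap.eq_adjoint_iff]
  intro u v
  rw [lp.inner_eq_tsum, lp.inner_eq_tsum,
    ← (Equiv.addRight (1 : ℤ)).tsum_eq fun k => ⟪u k, T v k⟫_ℂ]
  refine tsum_congr fun k => ?_
  simp only [Equiv.coe_addRight, T_apply, add_sub_cancel_right]
  rfl

theorem adjoint_T_apply (u : EllTwo) (k : ℤ) :
    ContinuousLinearMap.adjoint T u k = u (k + 1) := by
  rw [adjoint_T]; rfl

theorem adjoint_T_e (k : ℤ) : ContinuousLinearMap.adjoint T (e k) = e (k - 1) := by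
  ext j
  simp only [adjoint_T_apply, e_apply, eq_sub_iff_add_eq]

theorem fourierEquiv_e (k : ℤ) :
    fourierEquiv (e k) =ᵐ[haarTorus] fourier (T := 2 * Real.pi) k := by
  have h : fourierEquiv (e k) = fourierLp 2 k := by
    rw [fourierEquiv, e, HilbertBasis.repr_symm_single, coe_fourierBasis]
  rw [h]
  exact coeFn_fourierLp 2 k

/-- The coordinate `z = e^{iθ}` on the torus. -/
def zCoord (θ : Torus) : ℂ := AddCircle.toCircle θ

theorem continuous_zCoord : Continuous zCoord :=
  continuous_subtype_val.comp AddCircle.continuous_toCircle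

theorem multiplier_zCoord : multiplier zCoord = T := by
  refine clm_ext_e fun k => ?_
  rw [T_e]
  apply fourierEquiv.injective
  apply Lp.ext
  filter_upwards [fourierEquiv_multiplier (memLp_top_of_continuous continuous_zCoord) (e k),
    fourierEquiv_e k, fourierEquiv_e (k + 1)] with θ h1 h2 h3
  rw [h1, h2, h3, add_comm, fourier_add, fourier_one, zCoord]

/-! ### The constant-coefficient GGT matrix as a function of the shift -/

theorem T_mem_unitary : T ∈ unitary (EllTwo →L[ℂ] EllTwo) := by
  rw [Unitary.mem_iff, ContinuousLinearMap.star_eq_adjoint]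
  constructor <;> refine clm_ext_e fun k => ?_ <;> simp [T_e, adjoint_T_e]

theorem norm_T_le : ‖T‖ ≤ 1 := LinearIsometry.norm_toContinuousLinearMap_le _

theorem norm_inv_smul_T_lt {a : ℝ} (ha : 1 < a) : ‖(a : ℂ)⁻¹ • T‖ < 1 := by
  have h0 : 0 < a := by linarith
  rw [norm_smul, norm_inv, Complex.norm_real, Real.norm_of_nonneg h0.le]
  calc a⁻¹ * ‖T‖ ≤ a⁻¹ * 1 := by gcongr; exact norm_T_le
    _ < 1 := by rw [mul_one]; exact inv_lt_one_of_one_lt₀ ha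

theorem T_pow_e (n : ℕ) (k : ℤ) : (T ^ n) (e k) = e (k + n) := by
  induction n with
  | zero => simp
  | succ n ih =>
    rw [pow_succ', mul_apply_eq_comp, ih, T_e, Nat.cast_succ, add_assoc]

theorem hasSum_geometric_T_e {a : ℝ} (ha : 1 < a) (k : ℤ) :
    HasSum (fun n : ℕ => ((a : ℂ)⁻¹ ^ n) • e (k + n))
      ((∑' j : ℕ, ((a : ℂ)⁻¹ • T) ^ j) (e k)) := by
  have h1 := (summable_geometric_of_norm_lt_one (norm_inv_smul_T_lt ha)).hasSum
  have h2 := h1.mapL (ContinuousLinearMap.apply ℂ EllTwo (e k))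
  refine h2.congr_fun fun n => ?_
  rw [ContinuousLinearMap.apply_apply, smul_pow, smul_apply, T_pow_e]

theorem isGGTRepresentation_constGGT {α : ℂ} {a : ℝ} (ha : 1 < a)
    (h : ‖α‖ ^ 2 + (a ^ 2)⁻¹ = 1) :
    IsGGTRepresentation (fun _ => α) (fun _ => a) (constGGT α a) := by
  refine ⟨fun _ => h, fun k => ⟨α • (∑' j : ℕ, ((a : ℂ)⁻¹ • T) ^ j) (e k), ?_, ?_⟩⟩
  · convert! (hasSum_geometric_T_e ha k).const_smul α using 2 with n
    -- The product over `Ioc k (k + n)` has `n` equal factors, which produces the geometric weight.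
    simp [smul_smul]
  · rw [smul_smul, Complex.conj_mul']
    simp [constGGT, adjoint_T_e]

theorem ofReal_sub_ne_zero {a : ℝ} (ha : 1 < a) {z : ℂ} (hz : ‖z‖ = 1) : (a : ℂ) - z ≠ 0 := by
  intro h
  have h1 : (a : ℂ) = z := sub_eq_zero.1 h
  rw [← h1, Complex.norm_real, Real.norm_of_nonneg (by linarith)] at hz
  linarith

theorem conj_eq_inv_of_norm_eq_one {z : ℂ} (hz : ‖z‖ = 1) : conj z = z⁻¹ := by
  rw [Complex.inv_def, Complex.normSq_eq_norm_sq, hz]; simp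

theorem ne_zero_of_norm_eq_one {z : ℂ} (hz : ‖z‖ = 1) : z ≠ 0 := by
  rintro rfl; simp at hz

/-- Partial fractions of `F_a` at its poles `0` and `a`, with `1 / z` written as `conj z` on the
circle. -/
theorem symbol_eq {α : ℂ} {a : ℝ} (ha : 1 < a) (h : ‖α‖ ^ 2 + (a ^ 2)⁻¹ = 1) {z : ℂ}
    (hz : ‖z‖ = 1) :
    symbol a z = (a : ℂ)⁻¹ * conj z - ((‖α‖ ^ 2 : ℝ) : ℂ) * (1 - (a : ℂ)⁻¹ * z)⁻¹ := by
  have h1 : ‖α‖ ^ 2 = 1 - (a ^ 2)⁻¹ := by linarith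
  have h2 := ofReal_sub_ne_zero ha hz
  have h3 := ne_zero_of_norm_eq_one hz
  have h4 : (a : ℂ) ≠ 0 := by exact_mod_cast (by linarith : a ≠ 0)
  have h5 : 1 - (a : ℂ)⁻¹ * z = ((a : ℂ) - z) / a := by field_simp
  rw [h1, conj_eq_inv_of_norm_eq_one hz, symbol, h5]
  push_cast
  field_simp
  ring

theorem one_sub_inv_mul_ne_zero {a : ℝ} (ha : 1 < a) {z : ℂ} (hz : ‖z‖ = 1) :
    1 - (a : ℂ)⁻¹ * z ≠ 0 := by
  have h4 : (a : ℂ) ≠ 0 := by exact_mod_cast (by linarith : a ≠ 0)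
  have h5 : 1 - (a : ℂ)⁻¹ * z = ((a : ℂ) - z) / a := by field_simp
  rw [h5]
  exact div_ne_zero (ofReal_sub_ne_zero ha hz) h4

theorem constGGT_eq_cfc {α : ℂ} {a : ℝ} (ha : 1 < a) (h : ‖α‖ ^ 2 + (a ^ 2)⁻¹ = 1) :
    constGGT α a = cfc (symbol a) T := by
  have hN : IsStarNormal T := isStarNormal_of_mem_unitary T_mem_unitary
  have hs : ∀ z ∈ spectrum ℂ T, ‖z‖ = 1 := fun z hz =>
    mem_sphere_zero_iff_norm.1 (spectrum.subset_circle_of_unitary T_mem_unitary hz)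
  have hne : ∀ z ∈ spectrum ℂ T, 1 - (a : ℂ)⁻¹ * z ≠ 0 := fun z hz =>
    one_sub_inv_mul_ne_zero ha (hs z hz)
  have hc : ContinuousOn (fun z : ℂ => (1 - (a : ℂ)⁻¹ * z)⁻¹) (spectrum ℂ T) :=
    ContinuousOn.inv₀ (by fun_prop) hne
  have h1 : cfc (symbol a) T = cfc (fun z => (a : ℂ)⁻¹ * star z -
      ((‖α‖ ^ 2 : ℝ) : ℂ) * (1 - (a : ℂ)⁻¹ * z)⁻¹) T :=
    cfc_congr fun z hz => symbol_eq ha h (hs z hz)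
  have h2 : cfc (fun z : ℂ => 1 - (a : ℂ)⁻¹ * z) T = 1 - (a : ℂ)⁻¹ • T := by
    rw [cfc_sub (fun _ => (1 : ℂ)) (fun z => (a : ℂ)⁻¹ * z) T, cfc_const_one ℂ T,
      cfc_const_mul_id (a : ℂ)⁻¹ T]
  rw [h1, cfc_sub (fun z => (a : ℂ)⁻¹ * star z)
      (fun z => ((‖α‖ ^ 2 : ℝ) : ℂ) * (1 - (a : ℂ)⁻¹ * z)⁻¹) T (by fun_prop)
      (continuousOn_const.mul hc),
    cfc_const_mul _ _ T (by fun_prop), cfc_const_mul _ _ T hc, cfc_star_id T,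
    cfc_inv (fun z : ℂ => 1 - (a : ℂ)⁻¹ * z) T hne (by fun_prop), h2,
    ← geom_series_eq_inverse _ (norm_inv_smul_T_lt ha)]
  rfl

theorem norm_zCoord (θ : Torus) : ‖zCoord θ‖ = 1 := Circle.norm_coe _

theorem memLp_zCoord : MemLp zCoord ⊤ haarTorus := memLp_top_of_continuous continuous_zCoord

theorem multiplier_star_zCoord :
    multiplier (star zCoord) = ContinuousLinearMap.adjoint T := by
  rw [multiplier_conj memLp_zCoord, multiplier_zCoord]

/-- The symbol of the resolvent `(1 - T / a)⁻¹`. -/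
def resolventSymbol (a : ℝ) (θ : Torus) : ℂ := (1 - (a : ℂ)⁻¹ * zCoord θ)⁻¹

theorem continuous_resolventSymbol {a : ℝ} (ha : 1 < a) : Continuous (resolventSymbol a) :=
  Continuous.inv₀ (by have := continuous_zCoord; fun_prop)
    fun θ => one_sub_inv_mul_ne_zero ha (norm_zCoord θ)

/-- The multiplier is a left inverse of `1 - T / a` and the Neumann series a right inverse, so they
coincide. -/
theorem multiplier_resolventSymbol {a : ℝ} (ha : 1 < a) :
    multiplier (resolventSymbol a) = ∑' j : ℕ, ((a : ℂ)⁻¹ • T) ^ j := by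
  have hR := memLp_top_of_continuous (continuous_resolventSymbol ha)
  have h0 : MemLp (1 : Torus → ℂ) ⊤ haarTorus := memLp_const 1
  have hx : MemLp ((1 : Torus → ℂ) - (a : ℂ)⁻¹ • zCoord) ⊤ haarTorus :=
    h0.sub (memLp_zCoord.const_smul _)
  have h1 : multiplier ((1 : Torus → ℂ) - (a : ℂ)⁻¹ • zCoord) = 1 - (a : ℂ)⁻¹ • T := by
    rw [multiplier_sub h0 (memLp_zCoord.const_smul _), multiplier_one,
      multiplier_smul memLp_zCoord, multiplier_zCoord]
  have h2 : multiplier (resolventSymbol a) * (1 - (a : ℂ)⁻¹ • T) = 1 := by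
    rw [← h1, ContinuousLinearMap.mul_def, ← multiplier_mul hR hx, ← multiplier_one]
    congr 1
    funext θ
    exact inv_mul_cancel₀ (one_sub_inv_mul_ne_zero ha (norm_zCoord θ))
  exact left_inv_eq_right_inv h2 (mul_neg_geom_series _ (norm_inv_smul_T_lt ha))

/-- The symbol of the GGT matrix on the torus. -/
def torusSymbol (a : ℝ) (θ : Torus) : ℂ := symbol a (zCoord θ)

theorem torusSymbol_eq {α : ℂ} {a : ℝ} (ha : 1 < a) (h : ‖α‖ ^ 2 + (a ^ 2)⁻¹ = 1) :
    torusSymbol a =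
      (a : ℂ)⁻¹ • star zCoord - ((‖α‖ ^ 2 : ℝ) : ℂ) • resolventSymbol a :=
  funext fun θ => symbol_eq ha h (norm_zCoord θ)

theorem continuous_torusSymbol {a : ℝ} (ha : 1 < a) : Continuous (torusSymbol a) := by
  have h := continuous_zCoord
  exact Continuous.div (by fun_prop) (by fun_prop) fun θ =>
    mul_ne_zero (ne_zero_of_norm_eq_one (norm_zCoord θ)) (ofReal_sub_ne_zero ha (norm_zCoord θ))

theorem multiplier_torusSymbol {α : ℂ} {a : ℝ} (ha : 1 < a) (h : ‖α‖ ^ 2 + (a ^ 2)⁻¹ = 1) :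
    multiplier (torusSymbol a) = constGGT α a := by
  have hR := memLp_top_of_continuous (continuous_resolventSymbol ha)
  have hz := memLp_zCoord.star
  rw [torusSymbol_eq ha h, multiplier_sub (hz.const_smul _) (hR.const_smul _),
    multiplier_smul hz, multiplier_smul hR, multiplier_star_zCoord, multiplier_resolventSymbol ha]
  rfl

/-- On the circle the numerator is `-z` times the conjugate of `a - z`. -/
theorem norm_symbol {a : ℝ} (ha : 1 < a) {z : ℂ} (hz : ‖z‖ = 1) : ‖symbol a z‖ = 1 := by
  have h2 := ofReal_sub_ne_zero ha hz
  have h3 : 1 - a * z = -(z * conj ((a : ℂ) - z)) := by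
    rw [map_sub, Complex.conj_ofReal, conj_eq_inv_of_norm_eq_one hz]
    field_simp [ne_zero_of_norm_eq_one hz]
    ring
  rw [symbol, h3, norm_div, norm_neg, norm_mul, norm_mul, RCLike.norm_conj]
  exact div_self (mul_ne_zero (by rw [hz]; exact one_ne_zero) (norm_ne_zero_iff.2 h2))

theorem constGGT_mem_unitary {α : ℂ} {a : ℝ} (ha : 1 < a) (h : ‖α‖ ^ 2 + (a ^ 2)⁻¹ = 1) :
    constGGT α a ∈ unitary (EllTwo →L[ℂ] EllTwo) := by
  have hF := memLp_top_of_continuous (continuous_torusSymbol ha)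
  have h1 : star (torusSymbol a) * torusSymbol a = 1 := by
    funext θ
    have := norm_symbol ha (norm_zCoord θ)
    simp only [Pi.mul_apply, Pi.star_apply, torusSymbol, RCLike.star_def, Complex.conj_mul', this]
    simp
  rw [Unitary.mem_iff, ContinuousLinearMap.star_eq_adjoint, ← multiplier_torusSymbol ha h,
    ← multiplier_conj hF, ContinuousLinearMap.mul_def, ContinuousLinearMap.mul_def,
    ← multiplier_mul hF.star hF, ← multiplier_mul hF hF.star, mul_comm (torusSymbol a), h1,
    multiplier_one]
  exact ⟨rfl, rfl⟩

/-! ### The commutator with the position operator -/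

/-- `W = [A, H_a]`, that is `W = z F_a'(z)` at `z = T`. -/
def positionCommutator (α : ℂ) (a : ℝ) : EllTwo →L[ℂ] EllTwo :=
  -((a : ℂ)⁻¹ • ContinuousLinearMap.adjoint T) - ((‖α‖ ^ 2 : ℝ) : ℂ) •
    (((a : ℂ)⁻¹ • T) * (∑' j : ℕ, ((a : ℂ)⁻¹ • T) ^ j) ^ 2)

/-- Uses `∑ n xⁿ = x / (1 - x)²` at `x = T / a`: only the term `n = j - k` reaches coordinate `j`.
-/
theorem geometric_T_coord {a : ℝ} (ha : 1 < a) (j k : ℤ) :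
    ((((a : ℂ)⁻¹ • T) * (∑' j : ℕ, ((a : ℂ)⁻¹ • T) ^ j) ^ 2) (e k)) j =
      ((j : ℂ) - k) * ((∑' j : ℕ, ((a : ℂ)⁻¹ • T) ^ j) (e k)) j := by
  have h1 := hasSum_coe_mul_geometric_of_norm_lt_one' (norm_inv_smul_T_lt ha)
  rw [← geom_series_eq_inverse _ (norm_inv_smul_T_lt ha)] at h1
  have h2 := h1.mapL (ContinuousLinearMap.apply ℂ EllTwo (e k))
  have h3 := h2.mapL (innerSL ℂ (e j))
  have h4 := ((hasSum_geometric_T_e ha k).mapL (innerSL ℂ (e j))).mul_left ((j : ℂ) - k)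
  simp only [innerSL_apply_apply, inner_e_left, ContinuousLinearMap.apply_apply] at h3 h4
  refine h3.unique (h4.congr_fun fun n => ?_)
  rw [← nsmul_eq_mul, smul_apply, smul_pow, smul_apply, T_pow_e, ← Nat.cast_smul_eq_nsmul ℂ]
  simp only [lp.coeFn_smul, Pi.smul_apply, smul_eq_mul, e_apply]
  split_ifs with hj
  · subst hj; push_cast; ring
  · simp

/-- Justifies reading `positionCommutator` as `[A, H_a]`: commuting with a diagonal matrix
multiplies entries by differences of its eigenvalues. -/
theorem positionCommutator_coord {α : ℂ} {a : ℝ} (ha : 1 < a) (j k : ℤ) :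
    (positionCommutator α a (e k)) j = ((j : ℂ) - k) * (constGGT α a (e k)) j := by
  have h1 := geometric_T_coord ha j k
  have h2 : positionCommutator α a (e k) = -((a : ℂ)⁻¹ • e (k - 1)) - ((‖α‖ ^ 2 : ℝ) : ℂ) •
      (((a : ℂ)⁻¹ • T) * (∑' j : ℕ, ((a : ℂ)⁻¹ • T) ^ j) ^ 2) (e k) := by
    rw [← adjoint_T_e]; rfl
  have h3 : constGGT α a (e k) = (a : ℂ)⁻¹ • e (k - 1) - ((‖α‖ ^ 2 : ℝ) : ℂ) •
      (∑' j : ℕ, ((a : ℂ)⁻¹ • T) ^ j) (e k) := by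
    rw [← adjoint_T_e]; rfl
  rw [h2, h3]
  simp only [lp.coeFn_sub, lp.coeFn_neg, lp.coeFn_smul, Pi.sub_apply, Pi.neg_apply, Pi.smul_apply,
    smul_eq_mul, e_apply, h1]
  split_ifs with hj
  · subst hj; push_cast; ring
  · ring

/-- The symbol of `H_a* B_a H_a - B_a`. -/
def defectSymbol (a : ℝ) (θ : Torus) : ℝ :=
  2 * (2 * (a * (zCoord θ).re - 1)) ^ 2 / ‖(a : ℂ) - zCoord θ‖ ^ 2

theorem continuous_defectSymbol {a : ℝ} (ha : 1 < a) : Continuous (defectSymbol a) := by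
  have h := continuous_zCoord
  have h1 : Continuous fun θ => (zCoord θ).re := Complex.continuous_re.comp h
  exact Continuous.div (by fun_prop) (by fun_prop) fun θ =>
    pow_ne_zero 2 (norm_ne_zero_iff.2 (ofReal_sub_ne_zero ha (norm_zCoord θ)))

theorem defectSymbol_nonneg (a : ℝ) (θ : Torus) : 0 ≤ defectSymbol a θ := by
  unfold defectSymbol; positivity

/-- The factor `conj F_a · z F_a'` is the phase derivative `2 (a Re z - 1) / |a - z|²`, and the
symbol of `G_a` supplies the same numerator, hence the square. Replacing `conj z` by `z⁻¹` leaves a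
rational identity in `z`. -/
theorem symbol_mul_commutator_eq {α : ℂ} {a : ℝ} (ha : 1 < a) (h : ‖α‖ ^ 2 + (a ^ 2)⁻¹ = 1)
    {z : ℂ} (hz : ‖z‖ = 1) :
    conj (symbol a z) * (2 * ((a * z + a * conj z - 2) * (-((a : ℂ)⁻¹ * conj z) -
      ((‖α‖ ^ 2 : ℝ) : ℂ) * ((a : ℂ)⁻¹ * z * (1 - (a : ℂ)⁻¹ * z)⁻¹ ^ 2)))) =
    ((2 * (2 * (a * z.re - 1)) ^ 2 / ‖(a : ℂ) - z‖ ^ 2 : ℝ) : ℂ) := by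
  have h1 : ‖α‖ ^ 2 = 1 - (a ^ 2)⁻¹ := by linarith
  have h2 := ofReal_sub_ne_zero ha hz
  have h3 := ne_zero_of_norm_eq_one hz
  have h4 : (a : ℂ) ≠ 0 := by exact_mod_cast (by linarith : a ≠ 0)
  have h5 : 1 - (a : ℂ)⁻¹ * z = ((a : ℂ) - z) / a := by field_simp
  have h6 := conj_eq_inv_of_norm_eq_one hz
  have h7 : (a : ℂ) * z - 1 ≠ 0 := by
    have h8 := mul_ne_zero h3 (ofReal_sub_ne_zero ha (z := z⁻¹) (by rw [norm_inv, hz, inv_one]))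
    rwa [mul_sub, mul_inv_cancel₀ h3, mul_comm] at h8
  have h8 : ((z.re : ℝ) : ℂ) = (z + z⁻¹) / 2 := by
    rw [← h6, Complex.re_eq_add_conj]
  have h9 : ((‖(a : ℂ) - z‖ : ℝ) : ℂ) ^ 2 = (a - z) * (a - z⁻¹) := by
    rw [← Complex.mul_conj', map_sub, Complex.conj_ofReal, h6]
  have h10 : (a : ℂ) - z⁻¹ = (a * z - 1) / z := by field_simp
  push_cast [h1, h9, h8, h10]
  rw [symbol, map_div₀, map_mul, map_sub, map_sub, map_mul, map_one, Complex.conj_ofReal, h6, h5,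
    h10]
  field_simp
  ring

/-- The operator `H_a* B_a H_a - B_a`, as a function of `T`. -/
def defect (α : ℂ) (a : ℝ) : EllTwo →L[ℂ] EllTwo :=
  ContinuousLinearMap.adjoint (constGGT α a) ∘L ((2 : ℂ) • (G a * positionCommutator α a))

theorem defect_eq_multiplier {α : ℂ} {a : ℝ} (ha : 1 < a) (h : ‖α‖ ^ 2 + (a ^ 2)⁻¹ = 1) :
    defect α a = multiplier fun θ => (defectSymbol a θ : ℂ) := by
  have hz := memLp_zCoord
  have hz' := hz.star
  have h0 : MemLp (1 : Torus → ℂ) ⊤ haarTorus := memLp_const 1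
  have hF := memLp_top_of_continuous (continuous_torusSymbol ha)
  have hR := memLp_top_of_continuous (continuous_resolventSymbol ha)
  have hR2 : MemLp (resolventSymbol a * resolventSymbol a) ⊤ haarTorus := hR.mul hR
  have hS : MemLp ((a : ℂ)⁻¹ • zCoord * (resolventSymbol a * resolventSymbol a)) ⊤ haarTorus :=
    hR2.mul (hz.const_smul _)
  have hG : MemLp ((a : ℂ) • zCoord + (a : ℂ) • star zCoord - (2 : ℂ) • (1 : Torus → ℂ)) ⊤
      haarTorus := ((hz.const_smul _).add (hz'.const_smul _)).sub (h0.const_smul _)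
  have hW : MemLp ((-1 : ℂ) • (a : ℂ)⁻¹ • star zCoord - ((‖α‖ ^ 2 : ℝ) : ℂ) •
      ((a : ℂ)⁻¹ • zCoord * (resolventSymbol a * resolventSymbol a))) ⊤ haarTorus :=
    ((hz'.const_smul _).const_smul _).sub (hS.const_smul _)
  have e1 : multiplier ((a : ℂ) • zCoord + (a : ℂ) • star zCoord - (2 : ℂ) • (1 : Torus → ℂ)) =
      G a := by
    rw [multiplier_sub ((hz.const_smul _).add (hz'.const_smul _)) (h0.const_smul _),
      multiplier_add (hz.const_smul _) (hz'.const_smul _), multiplier_smul hz, multiplier_smul hz',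
      multiplier_smul h0, multiplier_one, multiplier_zCoord, multiplier_star_zCoord]
    rfl
  have e2 : multiplier ((-1 : ℂ) • (a : ℂ)⁻¹ • star zCoord - ((‖α‖ ^ 2 : ℝ) : ℂ) •
      ((a : ℂ)⁻¹ • zCoord * (resolventSymbol a * resolventSymbol a))) =
      positionCommutator α a := by
    rw [multiplier_sub ((hz'.const_smul _).const_smul _) (hS.const_smul _),
      multiplier_smul (hz'.const_smul _), multiplier_smul hz', multiplier_smul hS,
      multiplier_mul (hz.const_smul _) hR2, multiplier_mul hR hR, multiplier_smul hz,
      multiplier_zCoord, multiplier_star_zCoord, multiplier_resolventSymbol ha,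
      positionCommutator, neg_one_smul, sq]
    rfl
  rw [defect, ← e1, ← e2, ← multiplier_torusSymbol ha h, ← multiplier_conj hF,
    ContinuousLinearMap.mul_def, ← multiplier_mul hG hW, ← multiplier_smul (hW.mul hG),
    ← multiplier_mul hF.star ((hW.mul hG).const_smul _)]
  congr 1
  funext θ
  rw [defectSymbol, ← symbol_mul_commutator_eq ha h (norm_zCoord θ)]
  simp [torusSymbol, resolventSymbol, sq, mul_assoc]

/-! ### Unbounded operators: cores, closures and commutators -/

section Abstract

variable {E : Type*} [NormedAddCommGroup E] [InnerProductSpace ℂ E]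

/-- A symmetric operator whose adjoint lies in its closure is essentially self-adjoint. -/
theorem isSelfAdjoint_closure [CompleteSpace E] {S : E →ₗ.[ℂ] E} (hd : Dense (S.domain : Set E))
    (hs : S.IsFormalAdjoint S) (h : S.adjoint.graph ≤ S.graph.topologicalClosure) :
    S.IsClosable ∧ IsSelfAdjoint S.closure := by
  have hcl : S.adjoint.IsClosed := S.adjoint_isClosed hd
  have hle : S ≤ S.adjoint := hs.le_adjoint hd
  have hS : S.IsClosable := hcl.isClosable.leIsClosable hle
  refine ⟨hS, ?_⟩
  have hd' : Dense (S.closure.domain : Set E) := hd.mono S.le_closure.1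
  have h1 : S.closure.graph = S.adjoint.graph := by
    rw [← hS.graph_closure_eq_closure_graph]
    exact le_antisymm (Submodule.topologicalClosure_minimal _
      (LinearPMap.le_graph_of_le hle) hcl) h
  rw [LinearPMap.isSelfAdjoint_def]
  apply LinearPMap.eq_of_eq_graph
  rw [LinearPMap.adjoint_graph_eq_graph_adjoint hd', h1,
    LinearPMap.adjoint_graph_eq_graph_adjoint hd]
  -- Being in the adjoint of a graph is a closed condition on the tested pairs, so testing on
  -- `S.graph` suffices for its closure, which contains `S.adjoint.graph` by `h`.
  ext x
  refine ⟨fun hx => ?_, fun hx => ?_⟩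
  · rw [Submodule.mem_adjoint_iff] at hx ⊢
    refine fun u v huv => hx u v ?_
    rw [← LinearPMap.adjoint_graph_eq_graph_adjoint hd]
    exact LinearPMap.le_graph_of_le hle huv
  · rw [Submodule.mem_adjoint_iff]
    intro u v huv
    rw [← LinearPMap.adjoint_graph_eq_graph_adjoint hd] at huv
    have hc : IsClosed {p : E × E | ⟪p.2, x.1⟫_ℂ - ⟪p.1, x.2⟫_ℂ = 0} :=
      isClosed_eq (by fun_prop) continuous_const
    have hsub : (S.graph : Set (E × E)) ⊆ {p : E × E | ⟪p.2, x.1⟫_ℂ - ⟪p.1, x.2⟫_ℂ = 0} :=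
      fun p hp => (Submodule.mem_adjoint_iff _ _).1 hx p.1 p.2 hp
    exact closure_minimal hsub hc (h huv)

/-- A commutator relation on the graph. -/
theorem isCommutator_iff_graph {A : E →ₗ.[ℂ] E} {B C : E →L[ℂ] E} :
    IsCommutator A B C ↔ ∀ p ∈ A.graph, ∀ q ∈ A.graph,
      ⟪p.2, B q.1⟫_ℂ - ⟪p.1, B q.2⟫_ℂ = ⟪p.1, C q.1⟫_ℂ := by
  constructor
  · rintro h p hp q hq
    obtain ⟨x, hx1, hx2⟩ := (LinearPMap.mem_graph_iff A).1 hp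
    obtain ⟨y, hy1, hy2⟩ := (LinearPMap.mem_graph_iff A).1 hq
    rw [← hx1, ← hx2, ← hy1, ← hy2]
    exact h x y
  · exact fun h x y => h _ (A.mem_graph x) _ (A.mem_graph y)

/-- On the graph both sides are continuous in each pair separately, so the identity passes to the
closure one variable at a time. -/
theorem IsCommutator.closure {A : E →ₗ.[ℂ] E} {B C : E →L[ℂ] E} (h : IsCommutator A B C)
    (hA : A.IsClosable) : IsCommutator A.closure B C := by
  rw [isCommutator_iff_graph] at h ⊢
  rw [← hA.graph_closure_eq_closure_graph]
  have h1 : ∀ p ∈ A.graph, ∀ q ∈ A.graph.topologicalClosure,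
      ⟪p.2, B q.1⟫_ℂ - ⟪p.1, B q.2⟫_ℂ = ⟪p.1, C q.1⟫_ℂ := fun p hp q hq =>
    closure_minimal (t := {q : E × E | ⟪p.2, B q.1⟫_ℂ - ⟪p.1, B q.2⟫_ℂ = ⟪p.1, C q.1⟫_ℂ})
      (fun q hq => h p hp q hq) (isClosed_eq (by fun_prop) (by fun_prop)) hq
  exact fun p hp q hq =>
    closure_minimal (t := {p : E × E | ⟪p.2, B q.1⟫_ℂ - ⟪p.1, B q.2⟫_ℂ = ⟪p.1, C q.1⟫_ℂ})
      (fun p hp => h1 p hp q hq) (isClosed_eq (by fun_prop) (by fun_prop)) hp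

/-- Commutator relations may be checked on a family spanning the domain. -/
theorem isCommutator_of_span {ι : Type*} {A : E →ₗ.[ℂ] E} {B C : E →L[ℂ] E} (b : ι → A.domain)
    (hb : A.domain ≤ Submodule.span ℂ (Set.range fun i => (b i : E)))
    (h : ∀ i j, ⟪A (b i), B (b j)⟫_ℂ - ⟪(b i : E), B (A (b j))⟫_ℂ = ⟪(b i : E), C (b j)⟫_ℂ) :
    IsCommutator A B C := by
  have htop : Submodule.span ℂ (Set.range b) = ⊤ := by
    refine Submodule.map_injective_of_injective A.domain.injective_subtype ?_
    rw [Submodule.map_span, ← Set.range_comp, Submodule.map_top, Submodule.range_subtype]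
    refine le_antisymm (Submodule.span_le.2 ?_) hb
    rintro _ ⟨i, rfl⟩
    exact (b i).2
  have hmem : ∀ φ : A.domain, φ ∈ Submodule.span ℂ (Set.range b) := fun φ => by
    rw [htop]; trivial
  have h1 : ∀ i (ψ : A.domain),
      ⟪A (b i), B ψ⟫_ℂ - ⟪(b i : E), B (A ψ)⟫_ℂ = ⟪(b i : E), C ψ⟫_ℂ := by
    intro i ψ
    induction hmem ψ using Submodule.span_induction with
    | mem x hx => obtain ⟨j, rfl⟩ := hx; exact h i j
    | zero => simp
    | add x y _ _ hx hy =>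
      simp only [LinearPMap.map_add, Submodule.coe_add, map_add, inner_add_right]
      linear_combination hx + hy
    | smul c x _ hx =>
      simp only [LinearPMap.map_smul, Submodule.coe_smul, map_smul, inner_smul_right]
      linear_combination c * hx
  intro φ ψ
  induction hmem φ using Submodule.span_induction with
  | mem x hx => obtain ⟨j, rfl⟩ := hx; exact h1 j ψ
  | zero => simp
  | add x y _ _ hx hy =>
    simp only [LinearPMap.map_add, Submodule.coe_add, inner_add_left]
    linear_combination hx + hy
  | smul c x _ hx =>
    simp only [LinearPMap.map_smul, Submodule.coe_smul, inner_smul_left]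
    linear_combination conj c * hx

end Abstract

/-! ### The conjugate operator on its core -/

theorem G_apply (a : ℝ) (u : EllTwo) (k : ℤ) :
    G a u k = a * u (k - 1) + a * u (k + 1) - 2 * u k := by
  rw [← adjoint_T_apply, ← T_apply]; rfl

theorem memℓp_position_e (k : ℤ) : e k ∈ position.domain := by
  change Memℓp (fun j : ℤ => (j : ℂ) * e k j) 2
  have h : (fun j : ℤ => (j : ℂ) * e k j) = ((k : ℂ) • e k : EllTwo) := by
    funext j
    rw [lp.coeFn_smul, Pi.smul_apply, e_apply]
    split_ifs with hj <;> simp [hj]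
  rw [h]
  exact lp.memℓp _

theorem G_e (a : ℝ) (k : ℤ) :
    G a (e k) = (a : ℂ) • e (k + 1) + (a : ℂ) • e (k - 1) - (2 : ℂ) • e k := by
  rw [← adjoint_T_e, ← T_e]; rfl

theorem span_e_le_domain (a : ℝ) : Submodule.span ℂ (Set.range e) ≤
    ((G a : EllTwo →ₗ[ℂ] EllTwo).compPMap position + precomp position (G a)).domain := by
  rw [Submodule.span_le]
  rintro _ ⟨k, rfl⟩
  refine ⟨memℓp_position_e k, ?_⟩
  change G a (e k) ∈ position.domain
  rw [G_e]
  exact sub_mem (add_mem (Submodule.smul_mem _ _ (memℓp_position_e _))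
    (Submodule.smul_mem _ _ (memℓp_position_e _))) (Submodule.smul_mem _ _ (memℓp_position_e _))

theorem domain_conjugateOpCore (a : ℝ) :
    (conjugateOpCore a).domain = Submodule.span ℂ (Set.range e) :=
  inf_eq_left.2 (span_e_le_domain a)

/-- `G_a(T) A + A G_a(T)` is the Jacobi matrix with off-diagonal entries `a (2 k + 1)` and
diagonal entries `-4 k`. -/
theorem conjugateOpCore_apply (a : ℝ) (u : (conjugateOpCore a).domain) (k : ℤ) :
    conjugateOpCore a u k = a * (2 * k - 1) * (u : EllTwo) (k - 1) +
      a * (2 * k + 1) * (u : EllTwo) (k + 1) - 4 * k * (u : EllTwo) k := by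
  have h1 : conjugateOpCore a u = G a (position ⟨u, u.2.2.1⟩) + position ⟨G a u, u.2.2.2⟩ := rfl
  have h2 : ∀ (v : position.domain) (j : ℤ), position v j = j * (v : EllTwo) j := fun _ _ => rfl
  rw [h1, lp.coeFn_add, Pi.add_apply, G_apply, h2, h2, h2, h2]
  simp only [G_apply]
  push_cast
  ring

/-- The canonical basis, inside the core. -/
def coreBasis (a : ℝ) (k : ℤ) : (conjugateOpCore a).domain :=
  ⟨e k, by rw [domain_conjugateOpCore]; exact Submodule.subset_span ⟨k, rfl⟩⟩

theorem conjugateOpCore_coreBasis (a : ℝ) (k : ℤ) : conjugateOpCore a (coreBasis a k) =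
    (a * (2 * k + 1) : ℂ) • e (k + 1) + (a * (2 * k - 1) : ℂ) • e (k - 1) - (4 * k : ℂ) • e k := by
  ext j
  rw [conjugateOpCore_apply]
  simp only [coreBasis, lp.coeFn_sub, lp.coeFn_add, lp.coeFn_smul, Pi.sub_apply, Pi.add_apply,
    Pi.smul_apply, smul_eq_mul, e_apply]
  have h1 : (j - 1 = k) ↔ j = k + 1 := by omega
  have h2 : (j + 1 = k) ↔ j = k - 1 := by omega
  simp only [h1, h2]
  rcases eq_or_ne j (k + 1) with rfl | h3
  · have h4 : k + 1 ≠ k - 1 := by omega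
    simp only [h4, add_eq_left, one_ne_zero, if_true, if_false]
    push_cast; ring
  rcases eq_or_ne j (k - 1) with rfl | h4
  · have h5 : k - 1 ≠ k := by omega
    simp only [h3, h5, if_true, if_false]
    push_cast; ring
  simp only [h3, h4, if_false]
  split_ifs with h5
  · subst h5; ring
  · ring

theorem inner_conjugateOpCore_coreBasis (a : ℝ) (k : ℤ) (x : EllTwo) :
    ⟪conjugateOpCore a (coreBasis a k), x⟫_ℂ =
      a * (2 * k + 1) * x (k + 1) + a * (2 * k - 1) * x (k - 1) - 4 * k * x k := by
  rw [conjugateOpCore_coreBasis, inner_sub_left, inner_add_left, inner_smul_left, inner_smul_left,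
    inner_smul_left, inner_e_left, inner_e_left, inner_e_left]
  simp [Complex.conj_ofNat]

theorem domain_le_span_coreBasis (a : ℝ) : (conjugateOpCore a).domain ≤
    Submodule.span ℂ (Set.range fun k => (coreBasis a k : EllTwo)) :=
  (domain_conjugateOpCore a).le

theorem isFormalAdjoint_conjugateOpCore (a : ℝ) :
    (conjugateOpCore a).IsFormalAdjoint (conjugateOpCore a) := by
  -- Symmetry says that the commutator form with the identity vanishes, which can be checked on
  -- basis vectors.
  have h : IsCommutator (conjugateOpCore a) 1 0 := by
    refine isCommutator_of_span (coreBasis a) (domain_le_span_coreBasis a) fun j k => ?_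
    rw [inner_conjugateOpCore_coreBasis]
    simp only [coreBasis, one_apply_eq_self, inner_e_left, zero_apply,
      inner_zero_right]
    rw [conjugateOpCore_apply, sub_eq_zero]
    ring
  intro u v
  have := h u v
  simpa [sub_eq_zero] using this

/-! ### Essential self-adjointness -/

theorem tendsto_of_dominated {f : ℕ → EllTwo} {g : EllTwo} {β : ℤ → ℝ}
    (hβ : Summable fun k => β k ^ 2) (hb : ∀ n k, ‖f n k - g k‖ ≤ β k)
    (hlim : ∀ k, Filter.Tendsto (fun n => f n k) Filter.atTop (nhds (g k))) :
    Filter.Tendsto f Filter.atTop (nhds g) := by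
  rw [tendsto_iff_norm_sub_tendsto_zero]
  have h1 : Filter.Tendsto (fun n => ∑' k, ‖f n k - g k‖ ^ 2) Filter.atTop
      (nhds (∑' _ : ℤ, (0 : ℝ))) := by
    refine tendsto_tsum_of_dominated_convergence hβ (fun k => ?_)
      (Filter.Eventually.of_forall fun n k => ?_)
    · have := (tendsto_iff_norm_sub_tendsto_zero.1 (hlim k)).pow 2
      simpa using this
    · rw [Real.norm_of_nonneg (by positivity)]
      exact pow_le_pow_left₀ (norm_nonneg _) (hb n k) 2
  rw [tsum_zero] at h1
  have h2 : ∀ n, ‖f n - g‖ = Real.sqrt (∑' k, ‖f n k - g k‖ ^ 2) := fun n => by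
    rw [← Real.sqrt_sq (norm_nonneg (f n - g))]
    congr 1
    have := lp.norm_rpow_eq_tsum (p := 2) (by norm_num) (f n - g)
    simpa using this
  simp only [h2]
  simpa using h1.sqrt

/-- The tent function of height one supported on `[-(n+1), n+1]`. -/
def tent (n : ℕ) (k : ℤ) : ℝ := max 0 (1 - |(k : ℝ)| / (n + 1))

theorem tent_nonneg (n : ℕ) (k : ℤ) : 0 ≤ tent n k := le_max_left _ _

theorem tent_le_one (n : ℕ) (k : ℤ) : tent n k ≤ 1 :=
  max_le zero_le_one (by have : 0 ≤ |(k : ℝ)| / (n + 1) := by positivity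
                         linarith)

theorem tent_eq_zero {n : ℕ} {k : ℤ} (h : (n + 1 : ℝ) ≤ |(k : ℝ)|) : tent n k = 0 :=
  max_eq_left (by
    have : 1 ≤ |(k : ℝ)| / (n + 1) := by rw [le_div_iff₀ (by positivity)]; linarith
    linarith)

theorem tendsto_tent (k : ℤ) : Filter.Tendsto (fun n => tent n k) Filter.atTop (nhds 1) := by
  have h1 : Filter.Tendsto (fun n : ℕ => |(k : ℝ)| * (1 / ((n : ℝ) + 1))) Filter.atTop
      (nhds (|(k : ℝ)| * 0)) := tendsto_one_div_add_atTop_nhds_zero_nat.const_mul _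
  have h2 := (tendsto_const_nhds (x := (0 : ℝ))).max ((tendsto_const_nhds (x := (1 : ℝ))).sub h1)
  simpa [tent, div_eq_mul_inv] using h2

theorem abs_tent_sub_le (n : ℕ) (k : ℤ) :
    |tent n (k + 1) - tent n k| ≤ 1 / (n + 1) := by
  have hn : (0 : ℝ) < n + 1 := by positivity
  refine (abs_max_sub_max_le_max _ _ _ _).trans ?_
  rw [sub_self, abs_zero, max_le_iff]
  refine ⟨by positivity, ?_⟩
  rw [sub_sub_sub_cancel_left, ← sub_div, abs_div, abs_of_pos hn]
  gcongr
  refine (abs_abs_sub_abs_le_abs_sub _ _).trans ?_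
  simp

/-- The slope `1 / (n + 1)` of the tent offsets the linear growth of the Jacobi entries: unless both
tent values vanish, `k` or `k + 1` lies within `n + 1` of zero, so `|2 k + 1| ≤ 3 (n + 1)`. -/
theorem abs_mul_tent_sub_le (n : ℕ) (k : ℤ) :
    |(2 * (k : ℝ) + 1) * (tent n (k + 1) - tent n k)| ≤ 3 := by
  have hn : (0 : ℝ) < n + 1 := by positivity
  by_cases h : (n + 1 : ℝ) ≤ |(k : ℝ)| ∧ (n + 1 : ℝ) ≤ |((k + 1 : ℤ) : ℝ)|
  · rw [tent_eq_zero h.1, tent_eq_zero h.2]; simp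
  · have h1 : |2 * (k : ℝ) + 1| ≤ 3 * (n + 1) := by
      push_cast at h
      rw [abs_le]
      rcases not_and_or.1 h with h | h <;> rw [not_le, abs_lt] at h <;> constructor <;> linarith
    rw [abs_mul]
    calc _ ≤ (3 * (n + 1 : ℝ)) * (1 / (n + 1)) := by gcongr; exact abs_tent_sub_le n k
      _ = 3 := by field_simp

/-- The finitely supported truncation of a sequence by a tent function. -/
def truncate (n : ℕ) (v : EllTwo) : EllTwo :=
  ∑ k ∈ Finset.Ioo (-(n + 1 : ℤ)) (n + 1), ((tent n k : ℂ) * v k) • e k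

theorem truncate_mem (n : ℕ) (v : EllTwo) :
    truncate n v ∈ Submodule.span ℂ (Set.range e) :=
  Submodule.sum_mem _ fun k _ => Submodule.smul_mem _ _ (Submodule.subset_span ⟨k, rfl⟩)

theorem truncate_apply (n : ℕ) (v : EllTwo) (k : ℤ) : truncate n v k = tent n k * v k := by
  rw [truncate, lp.coeFn_sum, Finset.sum_apply]
  simp only [lp.coeFn_smul, Pi.smul_apply, e_apply, smul_eq_mul, mul_ite, mul_one, mul_zero]
  rw [Finset.sum_ite_eq]
  split_ifs with h
  · rfl
  · rw [tent_eq_zero, Complex.ofReal_zero, zero_mul]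
    rw [Finset.mem_Ioo, ← abs_lt, not_lt] at h
    exact_mod_cast h

theorem summable_sq_norm (u : EllTwo) : Summable fun k => ‖u k‖ ^ 2 := by
  have := (memℓp_gen_iff (p := 2) (by norm_num)).1 (lp.memℓp u)
  simpa using this

theorem tendsto_truncate (v : EllTwo) :
    Filter.Tendsto (fun n => truncate n v) Filter.atTop (nhds v) := by
  refine tendsto_of_dominated (summable_sq_norm v) (fun n k => ?_) fun k => ?_
  · rw [truncate_apply, ← sub_one_mul, norm_mul]
    refine mul_le_of_le_one_left (norm_nonneg _) ?_
    rw [← Complex.ofReal_one, ← Complex.ofReal_sub, Complex.norm_real, Real.norm_eq_abs, abs_le]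
    constructor <;> linarith [tent_nonneg n k, tent_le_one n k]
  · simp only [truncate_apply]
    have h1 := (Complex.continuous_ofReal.tendsto _).comp (tendsto_tent k)
    simpa using h1.mul_const (v k)

/-- Pairing with `e k` alone shows that the adjoint acts by the same Jacobi formula. -/
theorem adjoint_conjugateOpCore_coord {a : ℝ} {v w : EllTwo}
    (h : (v, w) ∈ (conjugateOpCore a).adjoint.graph) (k : ℤ) :
    w k = a * (2 * k + 1) * v (k + 1) + a * (2 * k - 1) * v (k - 1) - 4 * k * v k := by
  have hd : Dense ((conjugateOpCore a).domain : Set EllTwo) := by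
    rw [domain_conjugateOpCore]; exact dense_span_e
  rw [LinearPMap.adjoint_graph_eq_graph_adjoint hd, Submodule.mem_adjoint_iff] at h
  have h1 := h _ _ ((conjugateOpCore a).mem_graph (coreBasis a k))
  rw [inner_conjugateOpCore_coreBasis, sub_eq_zero] at h1
  rw [h1]
  exact (inner_e_left k w).symm

theorem sq_add_add_le (x y z : ℝ) : (x + y + z) ^ 2 ≤ 3 * x ^ 2 + 3 * y ^ 2 + 3 * z ^ 2 := by
  nlinarith [sq_nonneg (x - y), sq_nonneg (x - z), sq_nonneg (y - z)]

theorem tendsto_conjugateOpCore_truncate {a : ℝ} (ha : 0 ≤ a) {v w : EllTwo}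
    (h : (v, w) ∈ (conjugateOpCore a).adjoint.graph)
    (hm : ∀ n, truncate n v ∈ (conjugateOpCore a).domain) :
    Filter.Tendsto (fun n => conjugateOpCore a ⟨truncate n v, hm n⟩) Filter.atTop (nhds w) := by
  -- The last two terms are the commutator of the Jacobi matrix with the tent. They are bounded
  -- uniformly in `n` by `abs_mul_tent_sub_le` and vanish entrywise in the limit.
  have key : ∀ n k, conjugateOpCore a ⟨truncate n v, hm n⟩ k = tent n k * w k +
      (a * ((2 * k + 1) * (tent n (k + 1) - tent n k) : ℝ) : ℂ) * v (k + 1) -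
      (a * ((2 * (k - 1 : ℤ) + 1) * (tent n (k - 1 + 1) - tent n (k - 1)) : ℝ) : ℂ) *
        v (k - 1) := by
    intro n k
    rw [conjugateOpCore_apply, adjoint_conjugateOpCore_coord h k]
    simp only [truncate_apply, sub_add_cancel]
    push_cast
    ring
  refine tendsto_of_dominated
    (β := fun k => ‖w k‖ + a * 3 * ‖v (k + 1)‖ + a * 3 * ‖v (k - 1)‖) ?_ (fun n k => ?_) fun k => ?_
  · have hw := summable_sq_norm w
    have hv1 := summable_sq_norm (ContinuousLinearMap.adjoint T v)
    have hv2 := summable_sq_norm (T v)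
    simp only [adjoint_T_apply, T_apply] at hv1 hv2
    refine Summable.of_nonneg_of_le (fun k => by positivity) (fun k => ?_)
      (((hw.mul_left 3).add (hv1.mul_left (3 * (a * 3) ^ 2))).add
        (hv2.mul_left (3 * (a * 3) ^ 2)))
    simpa only [mul_pow, mul_assoc] using sq_add_add_le (‖w k‖) (a * 3 * ‖v (k + 1)‖)
      (a * 3 * ‖v (k - 1)‖)
  · have hbd : ∀ j : ℤ, ∀ x : ℂ,
        ‖(a * ((2 * j + 1) * (tent n (j + 1) - tent n j) : ℝ) : ℂ) * x‖ ≤ a * 3 * ‖x‖ := by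
      intro j x
      rw [norm_mul, norm_mul, Complex.norm_real, Complex.norm_real, Real.norm_of_nonneg ha,
        Real.norm_eq_abs]
      gcongr
      exact abs_mul_tent_sub_le n j
    have h1 : ‖(tent n k : ℂ) * w k - w k‖ ≤ ‖w k‖ := by
      rw [← sub_one_mul, norm_mul]
      refine mul_le_of_le_one_left (norm_nonneg _) ?_
      rw [← Complex.ofReal_one, ← Complex.ofReal_sub, Complex.norm_real, Real.norm_eq_abs, abs_le]
      constructor <;> linarith [tent_nonneg n k, tent_le_one n k]
    rw [key, add_sub_assoc, add_sub_right_comm, ← add_sub_assoc]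
    exact (norm_sub_le _ _).trans (add_le_add ((norm_add_le _ _).trans
      (add_le_add h1 (hbd k _))) (hbd (k - 1) _))
  · simp only [key]
    have ht : ∀ j : ℤ, Filter.Tendsto
        (fun n => (a * ((2 * j + 1) * (tent n (j + 1) - tent n j) : ℝ) : ℂ))
        Filter.atTop (nhds 0) := fun j => by
      have h1 := (((tendsto_tent (j + 1)).sub (tendsto_tent j)).const_mul
        (2 * (j : ℝ) + 1)).const_mul a
      have h2 := (Complex.continuous_ofReal.tendsto _).comp h1
      simpa [Function.comp_def] using h2
    have h1 := ((Complex.continuous_ofReal.tendsto _).comp (tendsto_tent k)).mul_const (w k)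
    have h2 := (h1.add ((ht k).mul_const (v (k + 1)))).sub ((ht (k - 1)).mul_const (v (k - 1)))
    simpa using h2

/-- Truncations of any `v` in the adjoint domain converge to it in graph norm, so the adjoint lies
in the closure of the core. -/
theorem conjugateOp_isSelfAdjoint {a : ℝ} (ha : 0 ≤ a) :
    (conjugateOpCore a).IsClosable ∧ IsSelfAdjoint (conjugateOp a) := by
  have hd : Dense ((conjugateOpCore a).domain : Set EllTwo) := by
    rw [domain_conjugateOpCore]; exact dense_span_e
  refine isSelfAdjoint_closure hd (isFormalAdjoint_conjugateOpCore a) ?_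
  rintro ⟨v, w⟩ hvw
  have hm : ∀ n, truncate n v ∈ (conjugateOpCore a).domain := fun n => by
    rw [domain_conjugateOpCore]; exact truncate_mem n v
  exact mem_closure_of_tendsto
    ((tendsto_truncate v).prodMk_nhds (tendsto_conjugateOpCore_truncate ha hvw hm))
    (Filter.Eventually.of_forall fun n => (conjugateOpCore a).mem_graph ⟨truncate n v, hm n⟩)

/-! ### The commutator of the GGT matrix with the conjugate operator -/

theorem constGGT_commute_T {α : ℂ} {a : ℝ} (ha : 1 < a) (h : ‖α‖ ^ 2 + (a ^ 2)⁻¹ = 1)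
    (u : EllTwo) : constGGT α a (T u) = T (constGGT α a u) := by
  have hF := memLp_top_of_continuous (continuous_torusSymbol ha)
  have h1 : constGGT α a ∘L T = T ∘L constGGT α a := by
    rw [← multiplier_torusSymbol ha h, ← multiplier_zCoord, ← multiplier_mul hF memLp_zCoord,
      ← multiplier_mul memLp_zCoord hF, mul_comm]
  exact DFunLike.congr_fun h1 u

theorem isConjugationDefect_defect {α : ℂ} {a : ℝ} (ha : 1 < a)
    (h : ‖α‖ ^ 2 + (a ^ 2)⁻¹ = 1) :
    IsConjugationDefect (conjugateOp a) (constGGT α a) (defect α a) := by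
  obtain ⟨hcl, hsa⟩ := conjugateOp_isSelfAdjoint (a := a) (by linarith)
  refine ⟨hsa, constGGT_mem_unitary ha h, _, IsCommutator.closure ?_ hcl, rfl⟩
  refine isCommutator_of_span (coreBasis a) (domain_le_span_coreBasis a) fun j k => ?_
  -- Commuting with `T` makes `H_a` a Laurent matrix, so columns `k ± 1` are shifts of column `k`
  -- and each entry of the commutator reduces to entries of that column.
  have h1 : ∀ m i : ℤ, constGGT α a (e (m + 1)) i = constGGT α a (e m) (i - 1) := fun m i => by
    rw [← T_e, constGGT_commute_T ha h, T_apply]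
  have h2 : ∀ i : ℤ, constGGT α a (e (k - 1)) i = constGGT α a (e k) (i + 1) := fun i => by
    have := h1 (k - 1) (i + 1)
    rw [sub_add_cancel, add_sub_cancel_right] at this
    exact this.symm
  rw [inner_conjugateOpCore_coreBasis, conjugateOpCore_coreBasis]
  simp only [coreBasis, inner_e_left, map_add, map_sub, map_smul, lp.coeFn_sub, lp.coeFn_add,
    lp.coeFn_smul, Pi.sub_apply, Pi.add_apply, Pi.smul_apply, smul_eq_mul, smul_apply,
    mul_apply_eq_comp, G_apply, positionCommutator_coord ha, h1, h2]
  push_cast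
  ring

/-! ### The phase of the symbol and the spectral family -/

/-- The map `f_a` of the torus with `e^{i f_a(θ)} = F_a(e^{iθ})`. -/
def phase {a : ℝ} (ha : 1 < a) (θ : Torus) : Torus :=
  (AddCircle.homeomorphCircle Real.two_pi_pos.ne').symm
    ⟨torusSymbol a θ, mem_sphere_zero_iff_norm.2 (norm_symbol ha (norm_zCoord θ))⟩

theorem zCoord_phase {a : ℝ} (ha : 1 < a) (θ : Torus) : zCoord (phase ha θ) = torusSymbol a θ := by
  rw [zCoord, ← AddCircle.homeomorphCircle_apply Real.two_pi_pos.ne']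
  exact congrArg Subtype.val (Homeomorph.apply_symm_apply _ _)

theorem continuous_phase {a : ℝ} (ha : 1 < a) : Continuous (phase ha) :=
  (Homeomorph.continuous _).comp ((continuous_torusSymbol ha).subtype_mk _)

theorem injective_zCoord : Function.Injective zCoord := fun _ _ h =>
  AddCircle.injective_toCircle Real.two_pi_pos.ne' (Subtype.ext h)

theorem zCoord_coe (x : ℝ) : zCoord (x : Torus) = Complex.exp (x * Complex.I) := by
  rw [zCoord, AddCircle.toCircle_apply_mk, div_self Real.two_pi_pos.ne', one_mul, Circle.coe_exp]

theorem memLp_indicator {S : Set Torus} (hS : MeasurableSet S) :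
    MemLp (S.indicator (1 : Torus → ℂ)) ⊤ haarTorus :=
  MemLp.indicator hS (memLp_const 1)

theorem ofReal_norm_sq_multiplier_indicator {S : Set Torus} (hS : MeasurableSet S) (u : EllTwo) :
    ENNReal.ofReal (‖multiplier (S.indicator 1) u‖ ^ 2) =
      ∫⁻ θ in S, ENNReal.ofReal (‖fourierEquiv u θ‖ ^ 2) ∂haarTorus := by
  have hi : Integrable (fun θ => ‖fourierEquiv u θ‖ ^ 2) haarTorus :=
    (Lp.memLp (fourierEquiv u)).integrable_norm_pow (by norm_num)
  rw [← ofReal_integral_eq_lintegral_ofReal hi.integrableOn (ae_of_all _ fun θ => by positivity)]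
  congr 1
  rw [← fourierEquiv.norm_map, ← @inner_self_eq_norm_sq ℂ, L2.inner_def, ← integral_re
    (L2.integrable_inner _ _), ← integral_indicator hS]
  refine integral_congr_ae ?_
  filter_upwards [fourierEquiv_multiplier (memLp_indicator hS) u] with θ h1
  rw [inner_self_eq_norm_sq, h1]
  by_cases hθ : θ ∈ S <;> simp [hθ]

/-- The spectral family of `H_a`: in the Fourier picture, multiplication by the indicator functions
of the sets `f_a⁻¹(Δ)`. -/
def spectralFamily {α : ℂ} {a : ℝ} (ha : 1 < a) (h : ‖α‖ ^ 2 + (a ^ 2)⁻¹ = 1) :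
    SpectralFamily (constGGT α a) where
  proj Δ := multiplier ((phase ha ⁻¹' Δ).indicator 1)
  isStarProjection_proj Δ hΔ := by
    have hS := memLp_indicator ((continuous_phase ha).measurable hΔ)
    refine ⟨?_, ?_⟩
    · rw [IsIdempotentElem, ContinuousLinearMap.mul_def, ← multiplier_mul hS hS]
      congr 1
      funext θ
      by_cases hθ : θ ∈ phase ha ⁻¹' Δ <;> simp [hθ]
    · rw [ContinuousLinearMap.isSelfAdjoint_iff', ← multiplier_conj hS]
      congr 1
      funext θ
      by_cases hθ : θ ∈ phase ha ⁻¹' Δ <;> simp [Set.indicator, hθ]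
  proj_univ := by rw [Set.preimage_univ, Set.indicator_univ, multiplier_one]
  measure u := (haarTorus.withDensity fun θ => ENNReal.ofReal (‖fourierEquiv u θ‖ ^ 2)).map
    (phase ha)
  measure_apply u Δ hΔ := by
    have hS := (continuous_phase ha).measurable hΔ
    rw [Measure.map_apply (continuous_phase ha).measurable hΔ, withDensity_apply _ hS,
      ofReal_norm_sq_multiplier_indicator hS]
  inner_eq_integral u := by
    change _ = ∫ θ, zCoord θ ∂_
    have hm : AEMeasurable (fun θ => ENNReal.ofReal (‖fourierEquiv u θ‖ ^ 2)) haarTorus :=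
      ((Lp.aestronglyMeasurable (fourierEquiv u)).norm.aemeasurable.pow_const 2).ennreal_ofReal
    rw [integral_map (continuous_phase ha).measurable.aemeasurable
      continuous_zCoord.aestronglyMeasurable,
      integral_withDensity_eq_integral_toReal_smul₀ hm (ae_of_all _ fun θ => ENNReal.ofReal_lt_top),
      ← multiplier_torusSymbol ha h, ← fourierEquiv.inner_map_map, L2.inner_def]
    refine integral_congr_ae ?_
    filter_upwards [fourierEquiv_multiplier
      (memLp_top_of_continuous (continuous_torusSymbol ha)) u] with θ h1
    rw [h1, zCoord_phase, ENNReal.toReal_ofReal (by positivity), RCLike.inner_apply, mul_assoc,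
      Complex.mul_conj', Complex.real_smul]
    push_cast
    ring

theorem finite_setOf_re_eq (r : ℝ) : {θ : Torus | (zCoord θ).re = r}.Finite := by
  refine Set.Finite.of_finite_image (f := zCoord) (Set.Finite.subset
    (Set.toFinite {⟨r, √(1 - r ^ 2)⟩, ⟨r, -√(1 - r ^ 2)⟩}) ?_) injective_zCoord.injOn
  rintro _ ⟨θ, hθ, rfl⟩
  have h1 : (zCoord θ).re ^ 2 + (zCoord θ).im ^ 2 = 1 := by
    have := Complex.sq_norm (zCoord θ)
    rw [norm_zCoord, Complex.normSq_apply] at this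
    linarith
  have hr : (zCoord θ).re = r := hθ
  rw [hr] at h1
  have h2 : (zCoord θ).im ^ 2 = √(1 - r ^ 2) ^ 2 := by
    rw [Real.sq_sqrt (by nlinarith [sq_nonneg (zCoord θ).im])]; linarith
  rcases sq_eq_sq_iff_eq_or_eq_neg.1 h2 with h3 | h3
  · exact Or.inl (Complex.ext hr h3)
  · exact Or.inr (Complex.ext hr h3)

theorem volume_torus : (volume : Measure Torus) = ENNReal.ofReal (2 * Real.pi) • haarTorus :=
  AddCircle.volume_eq_smul_haarAddCircle

theorem haarTorus_absolutelyContinuous : haarTorus ≪ (volume : Measure Torus) := by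
  rw [volume_torus]
  exact Measure.absolutelyContinuous_smul (by simp [Real.pi_pos])

theorem volume_setOf_re_eq (r : ℝ) : volume {θ : Torus | (zCoord θ).re = r} = 0 :=
  haveI : NullSingletonClass (volume : Measure Torus) := ⟨fun x => by
    rw [← Metric.closedBall_zero, AddCircle.volume_closedBall]; simp⟩
  (finite_setOf_re_eq r).measure_zero _

theorem defectSymbol_eq_zero_iff {a : ℝ} (ha : 1 < a) (θ : Torus) :
    defectSymbol a θ = 0 ↔ (zCoord θ).re = a⁻¹ := by
  have h1 : ‖(a : ℂ) - zCoord θ‖ ^ 2 ≠ 0 :=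
    pow_ne_zero 2 (norm_ne_zero_iff.2 (ofReal_sub_ne_zero ha (norm_zCoord θ)))
  have h2 : a ≠ 0 := by linarith
  rw [defectSymbol, div_eq_zero_iff, or_iff_left h1, mul_eq_zero, or_iff_right two_ne_zero,
    sq_eq_zero_iff, mul_eq_zero, or_iff_right two_ne_zero, sub_eq_zero, mul_comm,
    ← eq_mul_inv_iff_mul_eq₀ h2, one_mul]

theorem ae_defectSymbol_ne_zero {a : ℝ} (ha : 1 < a) :
    ∀ᵐ θ ∂haarTorus, (defectSymbol a θ : ℂ) ≠ 0 := by
  refine haarTorus_absolutelyContinuous.ae_le ?_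
  filter_upwards [measure_eq_zero_iff_ae_notMem.1 (volume_setOf_re_eq a⁻¹)] with θ hθ h0
  exact hθ ((defectSymbol_eq_zero_iff ha θ).1 (by exact_mod_cast h0))

theorem isWeaklyPropagating_constGGT {α : ℂ} {a : ℝ} (ha : 1 < a)
    (h : ‖α‖ ^ 2 + (a ^ 2)⁻¹ = 1) : IsWeaklyPropagating (constGGT α a) (conjugateOp a) := by
  have hd : MemLp (fun θ => (defectSymbol a θ : ℂ)) ⊤ haarTorus :=
    memLp_top_of_continuous (Complex.continuous_ofReal.comp (continuous_defectSymbol ha))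
  refine ⟨defect α a, isConjugationDefect_defect ha h, ?_, ?_⟩
  · rw [defect_eq_multiplier ha h]
    exact multiplier_isPositive hd (defectSymbol_nonneg a)
  · rw [defect_eq_multiplier ha h]
    exact multiplier_injective hd (ae_defectSymbol_ne_zero ha)

/-! ### Strict propagation -/

/-- The quotient map is injective on each period, so the interval is cut into periods and the
injective continuous images are Borel by Lusin–Souslin. -/
theorem IsArc.measurableSet {Θ : Set Torus} (h : IsArc Θ) : MeasurableSet Θ := by
  obtain ⟨I, hI, rfl⟩ := h
  have h1 : I = ⋃ n : ℤ, I ∩ Set.Ico (n • (2 * Real.pi)) ((n + 1) • (2 * Real.pi)) := by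
    rw [← Set.inter_iUnion, iUnion_Ico_zsmul Real.two_pi_pos, Set.inter_univ]
  rw [h1, Set.image_iUnion]
  refine MeasurableSet.iUnion fun n => MeasurableSet.image_of_continuousOn_injOn
    (hI.measurableSet.inter measurableSet_Ico) (AddCircle.continuous_mk' _).continuousOn ?_
  intro x hx y hy hxy
  refine (AddCircle.coe_eq_coe_iff_of_mem_Ico (a := n • (2 * Real.pi)) ?_ ?_).1 hxy
  · simpa [add_smul] using hx.2
  · simpa [add_smul] using hy.2

theorem zCoord_argPos {z : ℂ} (hz : ‖z‖ = 1) : zCoord (argPos z : Torus) = z := by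
  have h1 : ((argPos z : ℝ) : Torus) = (z.arg : Torus) := by
    rw [argPos, toIcoMod, AddCircle.coe_sub, AddCircle.coe_zsmul, AddCircle.coe_period, smul_zero,
      sub_zero]
  rw [h1, zCoord_coe]
  have := Complex.norm_mul_exp_arg_mul_I z
  rwa [hz, Complex.ofReal_one, one_mul] at this

theorem phase_coe_eq_argPos {a : ℝ} (ha : 1 < a) (x : ℝ) :
    phase ha (x : Torus) = (argPos (circleSymbol a x) : Torus) := by
  have h1 : circleSymbol a x = torusSymbol a (x : Torus) := by
    rw [circleSymbol, torusSymbol, zCoord_coe, Circle.coe_exp]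
  apply injective_zCoord
  rw [zCoord_phase, h1]
  exact (zCoord_argPos (norm_symbol ha (norm_zCoord _))).symm

theorem eq_of_re_zCoord_eq {a : ℝ} (ha : 1 < a) {θ : Torus} (h : (zCoord θ).re = a⁻¹) :
    θ = (Real.arccos a⁻¹ : Torus) ∨ θ = ((-Real.arccos a⁻¹ : ℝ) : Torus) := by
  obtain ⟨x, rfl⟩ := QuotientAddGroup.mk_surjective θ
  have h1 : Real.cos x = Real.cos (Real.arccos a⁻¹) := by
    have h2 : a⁻¹ < 1 := inv_lt_one_of_one_lt₀ ha
    have h3 : 0 < a⁻¹ := inv_pos.2 (by linarith)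
    rw [Real.cos_arccos (by linarith) h2.le, ← h]
    change _ = (zCoord (x : Torus)).re
    rw [zCoord_coe, Complex.exp_ofReal_mul_I_re]
  exact Real.Angle.cos_eq_iff_coe_eq_or_eq_neg.1 h1

theorem isStrictlyPropagatingOn_constGGT {α : ℂ} {a : ℝ} (ha : 1 < a)
    (h : ‖α‖ ^ 2 + (a ^ 2)⁻¹ = 1) {Θ : Set Torus} (hΘ : MeasurableSet Θ)
    (hl : (arcLower a : Torus) ∉ closure Θ) (hu : (arcUpper a : Torus) ∉ closure Θ) :
    IsStrictlyPropagatingOn (constGGT α a) (conjugateOp a) Θ := by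
  set S := phase ha ⁻¹' Θ with hSdef
  have hS : MeasurableSet S := (continuous_phase ha).measurable hΘ
  -- A zero of the symbol is one of `±θ_a`, whose phase is an endpoint of `Θ_a`; by continuity that
  -- endpoint would lie in `closure Θ`.
  have hpos : ∀ θ ∈ closure S, 0 < defectSymbol a θ := by
    intro θ hθ
    refine lt_of_le_of_ne (defectSymbol_nonneg a θ) fun h0 => ?_
    have hcl : phase ha θ ∈ closure Θ :=
      (continuous_phase ha).closure_preimage_subset Θ hθ
    rcases eq_of_re_zCoord_eq ha ((defectSymbol_eq_zero_iff ha θ).1 h0.symm) with rfl | rfl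
    · rw [phase_coe_eq_argPos] at hcl; exact hu hcl
    · rw [phase_coe_eq_argPos] at hcl; exact hl hcl
  obtain ⟨c, hc, hcS⟩ : ∃ c : ℝ, 0 < c ∧ ∀ θ ∈ S, c ≤ defectSymbol a θ := by
    rcases (closure S).eq_empty_or_nonempty with he | hne
    -- With `S` empty any positive constant serves.
    · exact ⟨1, one_pos, fun θ hθ => by
        have := subset_closure hθ; rw [he] at this; exact this.elim⟩
    · obtain ⟨θ₀, h1, h2⟩ := isClosed_closure.isCompact.exists_isMinOn hne
        (continuous_defectSymbol ha).continuousOn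
      exact ⟨_, hpos θ₀ h1, fun θ hθ => h2 (subset_closure hθ)⟩
  refine ⟨hΘ, defect α a, isConjugationDefect_defect ha h, spectralFamily ha h, c, hc, ?_⟩
  have hd : MemLp (fun θ => (defectSymbol a θ : ℂ)) ⊤ haarTorus :=
    memLp_top_of_continuous (Complex.continuous_ofReal.comp (continuous_defectSymbol ha))
  have hI := memLp_indicator hS
  have h2 : (fun θ => ((S.indicator (fun θ => defectSymbol a θ - c) θ : ℝ) : ℂ)) =
      S.indicator 1 * ((fun θ => (defectSymbol a θ : ℂ)) * S.indicator 1) -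
        (c : ℂ) • S.indicator 1 := by
    funext θ
    by_cases hθ : θ ∈ S <;> simp [hθ]
  have hm1 : MemLp ((fun θ => (defectSymbol a θ : ℂ)) * S.indicator 1) ⊤ haarTorus := hI.mul hd
  have hm : MemLp (S.indicator 1 * ((fun θ => (defectSymbol a θ : ℂ)) * S.indicator 1)) ⊤
      haarTorus := hm1.mul hI
  have h3 : (spectralFamily ha h).proj Θ ∘L defect α a ∘L (spectralFamily ha h).proj Θ -
      (c : ℂ) • (spectralFamily ha h).proj Θ =
      multiplier fun θ => ((S.indicator (fun θ => defectSymbol a θ - c) θ : ℝ) : ℂ) := by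
    rw [h2, multiplier_sub hm (hI.const_smul _), multiplier_mul hI hm1,
      multiplier_mul hd hI, multiplier_smul hI, defect_eq_multiplier ha h]
    rfl
  rw [h3]
  refine multiplier_isPositive ?_ fun θ => ?_
  · rw [h2]; exact hm.sub (hI.const_smul _)
  · exact Set.indicator_nonneg (fun θ hθ => sub_nonneg.2 (hcS θ hθ)) θ

/-! ### Absolute continuity -/

/-- Preimages of null sets under a `C¹` function are null away from its critical points. -/
theorem volume_preimage_inter_deriv_ne_zero {f f' : ℝ → ℝ}
    (hf : ∀ x, HasStrictDerivAt f (f' x) x) {N : Set ℝ} (hN : volume N = 0) :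
    volume (f ⁻¹' N ∩ {x | f' x ≠ 0}) = 0 := by
  have hfm : Measurable f := (continuous_iff_continuousAt.2 fun x => (hf x).hasDerivAt.continuousAt).measurable
  have hf'm : Measurable f' := by
    have : f' = deriv f := funext fun x => (hf x).hasDerivAt.deriv.symm
    rw [this]; exact measurable_deriv f
  refine measure_null_of_locally_null _ fun x hx => ?_
  -- The inverse function theorem makes `f` injective near `x`. Change of variables then gives `∫
  -- |f'| = 0` over a set where `f' ≠ 0`, so that set is null.
  let ψ := ((hf x).hasStrictFDerivAt_equiv hx.2).toOpenPartialHomeomorph f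
  have hψ : x ∈ ψ.source :=
    ((hf x).hasStrictFDerivAt_equiv hx.2).mem_toOpenPartialHomeomorph_source
  -- `N` is an arbitrary null set, so its measurable hull is used to make `s` measurable.
  set s := ψ.source ∩ (f ⁻¹' toMeasurable volume N ∩ {x | f' x ≠ 0}) with hs
  have hsm : MeasurableSet s := ψ.open_source.measurableSet.inter
    ((hfm (measurableSet_toMeasurable _ _)).inter (hf'm (measurableSet_singleton 0).compl))
  refine ⟨s, ?_, ?_⟩
  · refine Filter.mem_of_superset (inter_mem_nhdsWithin _ (ψ.open_source.mem_nhds hψ)) ?_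
    rintro y ⟨hy1, hy2⟩
    exact ⟨hy2, subset_toMeasurable _ _ hy1.1, hy1.2⟩
  · have hinj : Set.InjOn f s := ψ.injOn.mono Set.inter_subset_left
    have h1 := lintegral_image_eq_lintegral_abs_deriv_mul hsm
      (fun y _ => (hf y).hasDerivAt.hasDerivWithinAt) hinj 1
    have h2 : volume (f '' s) = 0 := by
      refine measure_mono_null ?_ ((measure_toMeasurable N).trans hN)
      rintro _ ⟨y, hy, rfl⟩
      exact hy.2.1
    simp only [Pi.one_apply, mul_one, lintegral_const, one_mul, Measure.restrict_apply_univ,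
      h2] at h1
    rw [eq_comm, lintegral_eq_zero_iff (by fun_prop), Filter.EventuallyEq,
      ae_restrict_iff' hsm, ae_iff] at h1
    refine measure_mono_null (fun y hy => ?_) h1
    have : f' y ≠ 0 := hy.2.2
    simp [hy, this]

/-- A smooth lift of the phase `f_a` to the real line, with values in `(0, 2π)`. -/
def phaseLift (a x : ℝ) : ℝ := Real.pi + 2 * Real.arctan (Real.sin x / (a - Real.cos x))

theorem sub_cos_pos {a : ℝ} (ha : 1 < a) (x : ℝ) : 0 < a - Real.cos x := by
  linarith [Real.cos_le_one x]

theorem phaseLift_mem {a x : ℝ} : phaseLift a x ∈ Set.Ioo 0 (2 * Real.pi) := by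
  have h1 := Real.neg_pi_div_two_lt_arctan (Real.sin x / (a - Real.cos x))
  have h2 := Real.arctan_lt_pi_div_two (Real.sin x / (a - Real.cos x))
  constructor <;> rw [phaseLift] <;> linarith

theorem hasStrictDerivAt_phaseLift {a : ℝ} (ha : 1 < a) (x : ℝ) :
    HasStrictDerivAt (phaseLift a)
      (2 * (a * Real.cos x - 1) / ((a - Real.cos x) ^ 2 + Real.sin x ^ 2)) x := by
  have h0 := sub_cos_pos ha x
  have h1 := ((((Real.hasStrictDerivAt_sin x).fun_div
    ((Real.hasStrictDerivAt_cos x).const_sub a) h0.ne').arctan).const_mul 2).const_add Real.pi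
  refine h1.congr_deriv ?_
  have h2 : (a - Real.cos x) ^ 2 + Real.sin x ^ 2 ≠ 0 := by positivity
  have h3 : 1 + (Real.sin x / (a - Real.cos x)) ^ 2 =
      ((a - Real.cos x) ^ 2 + Real.sin x ^ 2) / (a - Real.cos x) ^ 2 := by
    field_simp
  rw [h3]
  field_simp
  linear_combination (-1 : ℝ) * Real.sin_sq_add_cos_sq x

theorem exp_two_mul_arctan (t : ℝ) :
    Complex.exp (2 * Real.arctan t * Complex.I) = (1 + t * Complex.I) / (1 - t * Complex.I) := by
  have h1 : (2 * Real.arctan t * Complex.I : ℂ) = (2 : ℕ) * (Real.arctan t * Complex.I) := by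
    push_cast; ring
  have h2 : (1 - t * Complex.I : ℂ) ≠ 0 := fun h => by simpa using congrArg Complex.re h
  have h3 : (0 : ℝ) < 1 + t ^ 2 := by positivity
  have h4 : ((√(1 + t ^ 2) : ℝ) : ℂ) ^ 2 = 1 + t ^ 2 := by
    rw [← Complex.ofReal_pow, Real.sq_sqrt h3.le]; push_cast; rfl
  have h5 : ((√(1 + t ^ 2) : ℝ) : ℂ) ≠ 0 := by
    exact_mod_cast (Real.sqrt_pos.2 h3).ne'
  rw [h1, Complex.exp_nat_mul, Complex.exp_mul_I, ← Complex.ofReal_cos, ← Complex.ofReal_sin,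
    Real.cos_arctan, Real.sin_arctan, eq_div_iff h2]
  push_cast
  have h6 : (1 / (√(1 + t ^ 2) : ℝ) + t / (√(1 + t ^ 2) : ℝ) * Complex.I : ℂ) ^ 2 =
      (1 + t * Complex.I) ^ 2 / (1 + t ^ 2) := by
    rw [← h4]; field_simp
  have h7 : (1 + t ^ 2 : ℂ) ≠ 0 := by exact_mod_cast h3.ne'
  rw [h6, div_mul_eq_mul_div, div_eq_iff h7]
  linear_combination (-(t : ℂ) ^ 2 * (1 + t * Complex.I)) * Complex.I_sq

/-- On the circle `F_a(z) = -(a - conj z) / (a - z)`. The sign gives `π`, and the quotient of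
conjugates gives twice the argument of `a - conj z = (a - cos x) + i sin x`. -/
theorem phase_coe {a : ℝ} (ha : 1 < a) (x : ℝ) :
    phase ha (x : Torus) = (phaseLift a x : Torus) := by
  apply injective_zCoord
  have h0 : ((a - Real.cos x : ℝ) : ℂ) ≠ 0 := by exact_mod_cast (sub_cos_pos ha x).ne'
  have h1 : ((phaseLift a x : ℝ) : ℂ) * Complex.I = Real.pi * Complex.I +
      2 * Real.arctan (Real.sin x / (a - Real.cos x)) * Complex.I := by
    rw [phaseLift]; push_cast; ring
  have hz : zCoord (x : Torus) = Real.cos x + Real.sin x * Complex.I := by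
    rw [zCoord_coe, Complex.exp_mul_I, ← Complex.ofReal_cos, ← Complex.ofReal_sin]
  have hn := norm_zCoord (x : Torus)
  have h2 := ofReal_sub_ne_zero ha hn
  have h3 := ne_zero_of_norm_eq_one hn
  rw [zCoord_phase, torusSymbol, symbol, zCoord_coe (phaseLift a x), h1, Complex.exp_add,
    Complex.exp_pi_mul_I, exp_two_mul_arctan]
  have h4 : (1 - ((Real.sin x / (a - Real.cos x) : ℝ) : ℂ) * Complex.I) =
      (a - zCoord (x : Torus)) / ((a - Real.cos x : ℝ) : ℂ) := by
    rw [hz, eq_div_iff h0, Complex.ofReal_div, sub_mul, mul_right_comm, div_mul_cancel₀ _ h0]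
    push_cast; ring
  have h5 : (1 + ((Real.sin x / (a - Real.cos x) : ℝ) : ℂ) * Complex.I) =
      (a - (zCoord (x : Torus))⁻¹) / ((a - Real.cos x : ℝ) : ℂ) := by
    rw [← conj_eq_inv_of_norm_eq_one hn, hz, eq_div_iff h0, Complex.ofReal_div, add_mul,
      mul_right_comm, div_mul_cancel₀ _ h0]
    simp only [map_add, map_mul, Complex.conj_ofReal, Complex.conj_I]
    push_cast; ring
  rw [h4, h5]
  field_simp
  ring

theorem map_phase_absolutelyContinuous {a : ℝ} (ha : 1 < a) :
    (volume : Measure Torus).map (phase ha) ≪ (volume : Measure Torus) := by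
  refine Measure.AbsolutelyContinuous.mk fun N hN h0 => ?_
  have hpre := (continuous_phase ha).measurable hN
  have hmp := AddCircle.measurePreserving_mk (2 * Real.pi) 0
  rw [zero_add] at hmp
  rw [Measure.map_apply (continuous_phase ha).measurable hN]
  -- The lift takes values in `(0, 2π)`, so a single period of the preimage of `N` is enough.
  have hM : volume (((↑) : ℝ → Torus) ⁻¹' N ∩ Set.Ioc 0 (2 * Real.pi)) = 0 := by
    rw [← Measure.restrict_apply' measurableSet_Ioc]
    exact (hmp.measure_preimage hN.nullMeasurableSet).trans h0
  have h1 := volume_preimage_inter_deriv_ne_zero (hasStrictDerivAt_phaseLift ha) hM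
  have hcrit := (hmp.measure_preimage
    (finite_setOf_re_eq a⁻¹).measurableSet.nullMeasurableSet).trans (volume_setOf_re_eq a⁻¹)
  rw [← hmp.measure_preimage hpre.nullMeasurableSet]
  refine measure_mono_null ?_ (measure_union_null
    (Measure.absolutelyContinuous_of_le Measure.restrict_le_self h1) hcrit)
  intro x hx
  by_cases hd : a * Real.cos x = 1
  · right
    change (zCoord (x : Torus)).re = a⁻¹
    rw [zCoord_coe, Complex.exp_ofReal_mul_I_re]
    exact eq_inv_of_mul_eq_one_right hd
  · left
    refine ⟨⟨?_, Set.Ioo_subset_Ioc_self phaseLift_mem⟩, ?_⟩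
    · change (phaseLift a x : Torus) ∈ N
      rw [← phase_coe ha]; exact hx
    · have h2 := sub_cos_pos ha x
      have h3 : (a - Real.cos x) ^ 2 + Real.sin x ^ 2 ≠ 0 := by positivity
      exact div_ne_zero (mul_ne_zero two_ne_zero (sub_ne_zero.2 hd)) h3

theorem hasPurelyACSpectrum_constGGT {α : ℂ} {a : ℝ} (ha : 1 < a)
    (h : ‖α‖ ^ 2 + (a ^ 2)⁻¹ = 1) : HasPurelyACSpectrum (constGGT α a) :=
  ⟨spectralFamily ha h, fun _ => (Measure.AbsolutelyContinuous.map
    ((withDensity_absolutelyContinuous _ _).trans haarTorus_absolutelyContinuous)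
    (continuous_phase ha).measurable).trans (map_phase_absolutelyContinuous ha)⟩

end GGT

end

theorem proposition5p2 (α : ℂ) (a : ℝ) (hα0 : α ≠ 0) (hα1 : ‖α‖ < 1) (ha : 1 < a)
    (h : ‖α‖ ^ 2 + (a ^ 2)⁻¹ = 1) :
    (GGT.IsGGTRepresentation (fun _ => α) (fun _ => a) (GGT.constGGT α a) ∧
      GGT.constGGT α a = cfc (GGT.symbol a) GGT.T) ∧
    GGT.IsWeaklyPropagating (GGT.constGGT α a) (GGT.conjugateOp a) ∧
    (∀ Θ : Set GGT.Torus, GGT.IsArc Θ → Θ ⊆ GGT.arc a →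
      (GGT.arcLower a : GGT.Torus) ∉ closure Θ → (GGT.arcUpper a : GGT.Torus) ∉ closure Θ →
      GGT.IsStrictlyPropagatingOn (GGT.constGGT α a) (GGT.conjugateOp a) Θ) ∧
    GGT.HasPurelyACSpectrum (GGT.constGGT α a) := by
  exact ⟨⟨GGT.isGGTRepresentation_constGGT ha h, GGT.constGGT_eq_cfc ha h⟩,
    GGT.isWeaklyPropagating_constGGT ha h,
    fun _ hΘ _ hl hu => GGT.isStrictlyPropagatingOn_constGGT ha h hΘ.measurableSet hl hu,
    GGT.hasPurelyACSpectrum_constGGT ha h⟩
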